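/- Consider vector fields $Q=a(t)\partial_t+b(t,x,u)\partial_x+c(t,x,u)\partial_u$ with smooth coefficients on open subsets of $\mathbb{R}^3$, taken up to equivalence transformations, that is, local smooth diffeomorphisms of the form $t'=T(t),\ x'=X(t,x,u),\ u'=U(t,x,u)$. A realization on an open set $\Omega\subseteq\mathbb R^3$ of the two-dimensional nonabelian Lie algebra $\mathsf A_{2.2}$ is a pair $e_1,e_2$ of such fields on $\Omega$, linearly independent over $\mathbb R$, with $[e_1,e_2]=e_1$. It is admissible if $e_1$ and $e_2$ are infinitesimal point symmetries of some evolution equation $u_t=F(t,x,u,u_1,u_2)\,u_3+G(t,x,u,u_1,u_2)$, $u_k=\partial_x^k u$, with $F,G$ smooth and $F\neq0$ everywhere on an open set of $(t,x,u,u_1,u_2)$ whose projection to $(t,x,u)$-space is $\Omega$. Call a point $p\in\Omega$ regular if $e_1(p)\ne0$ and both the rank of $\langle e_1,e_2\rangle$ and the rank of its projection to the $t$-axis (that is, the dimension of the span of the two coefficients of $\partial_t$ at the point) are constant in a neighbourhood of $p$. **Proposition.** Let $$\mathsf A^1_{2.2}=\langle\partial_t,\ t\partial_t+x\partial_x\rangle,\quad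 \mathsf A^2_{2.2}=\langle\partial_x,\ t\partial_t+x\partial_x\rangle,\quad \mathsf A^3_{2.2}=\langle\partial_x,\ x\partial_x+u\partial_u\rangle,\quad \mathsf A^4_{2.2}=\langle\partial_x,\ x\partial_x\rangle .$$ 1. Each $\mathsf A^k_{2.2}$ is an admissible realization of $\mathsf A_{2.2}$ on $\mathbb R^3$. 2. If $\langle e_1,e_2\rangle$ is an admissible realization of $\mathsf A_{2.2}$ on an open set $\Omega\subseteq\mathbb R^3$, then every regular point of $\Omega$ has an open neighbourhood $V\subseteq\Omega$ and an equivalence transformation on $V$ that carries the Lie algebra $\langle e_1,e_2\rangle$ restricted to $V$ onto one of the $\mathsf A^k_{2.2}$ restricted to the image of $V$. The regular points are dense in $\{p\in\Omega: e_1(p)\neq0\}$. 3. For $k\ne l$ there is no equivalence transformation, defined on any nonempty open set, that carries $\mathsf A^k_{2.2}$ onto $\mathsf A^l_{2.2}$. -/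

import Mathlib

open Set Topology
open scoped ContDiff

namespace EvolutionSymmetry

/-- The space of the variables `(t, x, u)`. -/
abbrev Base := Fin 3 → ℝ

/-- The space of the variables `(t, x, u, u_1, u_2)`, where `u_k` is the `k`-th `x`-derivative. -/
abbrev Jet2 := Fin 5 → ℝ

/-- The space of the variables `(t, x, u, u_1, u_2, u_3)`. -/
abbrev Jet3 := Fin 6 → ℝ

def baseOfJet2 (w : Jet2) : Base := ![w 0, w 1, w 2]

def baseOfJet3 (z : Jet3) : Base := ![z 0, z 1, z 2]

def jet2OfJet3 (z : Jet3) : Jet2 := ![z 0, z 1, z 2, z 3, z 4]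

/-- Partial derivative with respect to the `i`-th coordinate. -/
noncomputable def pd {n : ℕ} (i : Fin n) (f : (Fin n → ℝ) → ℝ) (p : Fin n → ℝ) : ℝ :=
  fderiv ℝ f p (Pi.single i 1)

/-- `Q = a(t) ∂_t + b(t,x,u) ∂_x + c(t,x,u) ∂_u` is a smooth vector field on `Ω`; the components
`Q p 0`, `Q p 1`, `Q p 2` are `a`, `b`, `c`. -/
def IsField (Ω : Set Base) (Q : Base → Base) : Prop :=
  ContDiffOn ℝ ∞ Q Ω ∧ ∃ a : ℝ → ℝ, ∀ p ∈ Ω, Q p 0 = a (p 0)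

/-- A realization on `Ω` of the Lie algebra with basis `e_1, e_2` and `[e_1, e_2] = e_1`, by
vector fields `a(t) ∂_t + b ∂_x + c ∂_u` (here `e_1 = e 0` and `e_2 = e 1`). -/
structure IsRealization (Ω : Set Base) (e : Fin 2 → Base → Base) : Prop where
  isField : ∀ i, IsField Ω (e i)
  linearIndependent : LinearIndependent ℝ (fun i => Ω.domRestrict (e i))
  bracket : ∀ p ∈ Ω, VectorField.lieBracket ℝ (e 0) (e 1) p = e 0 p

/-! ### Prolongation of vector fields and symmetries of evolution equations -/

/-- The total `x`-derivative of a function of `(t, x, u, u_1, u_2)`, at a point of `Jet3`. -/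
noncomputable def totalDx (f : Jet3 → ℝ) (z : Jet3) : ℝ :=
  pd 1 f z + z 3 * pd 2 f z + z 4 * pd 3 f z + z 5 * pd 4 f z

/-- The total `t`-derivative of a function of `(t, x, u)`, where `ut` is the value of `u_t`. -/
noncomputable def totalDt (f : Base → ℝ) (p : Base) (ut : ℝ) : ℝ :=
  pd 0 f p + ut * pd 2 f p

/-- The total `x`-derivative of the coefficient `b` of `∂_x` in `Q`. -/
noncomputable def totalDxB (Q : Base → Base) : Jet3 → ℝ :=
  totalDx (fun y => Q (baseOfJet3 y) 1)

/-- Coefficient of `∂/∂u_1` in the prolongation of `Q`: `D_x c - u_1 D_x b`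
(the term `- u_t D_x a` is absent because `a` depends on `t` only). -/
noncomputable def prol1 (Q : Base → Base) (z : Jet3) : ℝ :=
  totalDx (fun y => Q (baseOfJet3 y) 2) z - z 3 * totalDxB Q z

/-- Coefficient of `∂/∂u_2` in the prolongation of `Q`. -/
noncomputable def prol2 (Q : Base → Base) (z : Jet3) : ℝ :=
  totalDx (prol1 Q) z - z 4 * totalDxB Q z

/-- Coefficient of `∂/∂u_3` in the prolongation of `Q`. -/
noncomputable def prol3 (Q : Base → Base) (z : Jet3) : ℝ :=
  totalDx (prol2 Q) z - z 5 * totalDxB Q z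

/-- Coefficient of `∂/∂u_t` in the prolongation of `Q`: `D_t c - u_t D_t a - u_1 D_t b`. -/
noncomputable def prolT (Q : Base → Base) (z : Jet3) (ut : ℝ) : ℝ :=
  totalDt (fun p => Q p 2) (baseOfJet3 z) ut
    - ut * totalDt (fun p => Q p 0) (baseOfJet3 z) ut
    - z 3 * totalDt (fun p => Q p 1) (baseOfJet3 z) ut

/-- The prolongation of `Q` applied to a function `H` of `(t, x, u, u_1, u_2)`. -/
noncomputable def prolApply (Q : Base → Base) (H : Jet2 → ℝ) (z : Jet3) : ℝ :=
  Q (baseOfJet3 z) 0 * pd 0 H (jet2OfJet3 z) + Q (baseOfJet3 z) 1 * pd 1 H (jet2OfJet3 z)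
    + Q (baseOfJet3 z) 2 * pd 2 H (jet2OfJet3 z)
    + prol1 Q z * pd 3 H (jet2OfJet3 z) + prol2 Q z * pd 4 H (jet2OfJet3 z)

/-- `Q` is an infinitesimal point symmetry of `u_t = F u_3 + G`, where `F` and `G` are functions
of `(t, x, u, u_1, u_2)` on `D`: the third prolongation of `Q` annihilates
`u_t - F u_3 - G` wherever `u_t = F u_3 + G`. -/
def IsSymmetry (D : Set Jet2) (F G : Jet2 → ℝ) (Q : Base → Base) : Prop :=
  ∀ z : Jet3, jet2OfJet3 z ∈ D →
    prolT Q z (F (jet2OfJet3 z) * z 5 + G (jet2OfJet3 z))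
      - (prolApply Q F z * z 5 + F (jet2OfJet3 z) * prol3 Q z) - prolApply Q G z = 0

/-- The fields `e` on `Ω` are admissible: they are symmetries of some equation
`u_t = F u_3 + G` with `F, G` smooth functions of `(t, x, u, u_1, u_2)` and `F ≠ 0`, given
over the whole of `Ω` (over a point of `Ω`, for some nonempty open set of `(u_1, u_2)`). -/
def IsAdmissible (Ω : Set Base) (e : Fin 2 → Base → Base) : Prop :=
  ∃ (D : Set Jet2) (F G : Jet2 → ℝ),
    IsOpen D ∧ baseOfJet2 '' D = Ω ∧ ContDiffOn ℝ ∞ F D ∧ ContDiffOn ℝ ∞ G D ∧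
    (∀ w ∈ D, F w ≠ 0) ∧ ∀ i, IsSymmetry D F G (e i)

/-! ### Equivalence -/

/-- `Φ` is an equivalence transformation `(t, x, u) ↦ (T(t), X(t,x,u), U(t,x,u))`, a smooth
diffeomorphism of the open set `V` onto its (open) image. -/
structure IsEquivTransformation (V : Set Base) (Φ : Base → Base) : Prop where
  isOpen : IsOpen V
  contDiffOn : ContDiffOn ℝ ∞ Φ V
  injOn : InjOn Φ V
  det_ne_zero : ∀ p ∈ V, (fderiv ℝ Φ p).det ≠ 0
  time : ∃ T : ℝ → ℝ, InjOn T ((fun p : Base => p 0) '' V) ∧ ∀ p ∈ V, Φ p 0 = T (p 0)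

/-- Some equivalence transformation on `V` carries the Lie algebra `⟨e_1, e_2⟩` restricted to `V`
onto the Lie algebra `⟨f_1, f_2⟩` restricted to the image of `V`; the invertible matrix `M`
is the change of basis. -/
def IsEquivalentOn (V : Set Base) (e f : Fin 2 → Base → Base) : Prop :=
  ∃ Φ : Base → Base, IsEquivTransformation V Φ ∧
    ∃ M : Matrix (Fin 2) (Fin 2) ℝ, M.det ≠ 0 ∧
      ∀ p ∈ V, ∀ i, fderiv ℝ Φ p (e i p) = ∑ j, M i j • f j (Φ p)

/-- The rank at `p` of the Lie algebra `⟨e_1, e_2⟩`. -/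
noncomputable def rankAt (e : Fin 2 → Base → Base) (p : Base) : ℕ :=
  Module.finrank ℝ (Submodule.span ℝ (range fun i => e i p))

/-- The rank at `p` of the projection of `⟨e_1, e_2⟩` to the `t`-axis: `1` if some coefficient of
`∂_t` is nonzero at `p`, and `0` otherwise. -/
noncomputable def timeRankAt (e : Fin 2 → Base → Base) (p : Base) : ℕ :=
  Module.finrank ℝ (Submodule.span ℝ (range fun i => e i p 0))

/-- Regular points: `e_1` does not vanish there, and the ranks of the algebra and of its projection
to the `t`-axis are constant nearby. -/
def IsRegularPoint (Ω : Set Base) (e : Fin 2 → Base → Base) (p : Base) : Prop :=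
  p ∈ Ω ∧ e 0 p ≠ 0 ∧ ∀ᶠ q in 𝓝 p, rankAt e q = rankAt e p ∧ timeRankAt e q = timeRankAt e p

/-- The four canonical realizations:
`⟨∂_t, t ∂_t + x ∂_x⟩`, `⟨∂_x, t ∂_t + x ∂_x⟩`, `⟨∂_x, x ∂_x + u ∂_u⟩`, `⟨∂_x, x ∂_x⟩`. -/
def canonical : Fin 4 → Fin 2 → Base → Base :=
  ![![fun _ => ![1, 0, 0], fun p => ![p 0, p 1, 0]],
    ![fun _ => ![0, 1, 0], fun p => ![p 0, p 1, 0]],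
    ![fun _ => ![0, 1, 0], fun p => ![0, p 1, p 2]],
    ![fun _ => ![0, 1, 0], fun p => ![0, p 1, 0]]]

end EvolutionSymmetry

/-! Write `a 0`, `a 1` for the time coefficients of `e_1`, `e_2`; they are functions of `t` alone,
and the bracket relation reads `a₀ a₁' - a₁ a₀' = a₀`. Normalizing the algebra amounts to finding
coordinates `τ(t)`, `X`, `U` on which the two fields act as prescribed, with independent
differentials (`exists_isEquivalentOn_of_coordinates`). Such functions come from the flow box
theorem and its consequence `exists_fderiv_apply_eq_zero_and_const`, which solves `e₁ f = 0`, `e₂ f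
= const` with prescribed differential at the point. The flow box in turn rests on a smooth local
flow, obtained by applying the inverse function theorem to the integral equation on a space of
curves.

At a regular point there are four surviving cases. If `a₀ ≠ 0`, then `τ = a₁/a₀` satisfies `e₁ τ =
1`, `e₂ τ = τ`; rank two gives the first form. If `a₀` vanishes at the point and `a₁` does not, the
linear equation above forces `a₀ = 0` nearby, and `τ = exp ∫ dt/a₁` gives the second form. If both
vanish, regularity makes them vanish nearby, and rank two or one gives the third or the fourth form.
A coordinate with `e₁ X = 1`, `e₂ X = X` comes from `exists_adapted_coordinate`, or in rank one is
the factor in `e₂ = X e₁`.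

Admissibility only serves to exclude `a₀ ≠ 0` in rank one. There `e₂ = τ(t) e₁` with `τ' ≠ 0`, and
if both were symmetries the characteristic of `e₁` would vanish on the equation for every `u_3`,
contrary to `F a₀ ≠ 0` (`not_isSymmetry_of_time_proportional`).

Regular points are dense because ranks are lower semicontinuous. The canonical algebras consist of
translations and scalings, so a monomial `F` of the right weight with `G = 0` is invariant. They are
told apart by their time coefficients and their ranks. -/

/-! ### Local inverses of smooth maps -/

section LocalInverse

variable {E F : Type*} [NormedAddCommGroup E] [NormedSpace ℝ E] [CompleteSpace E]
  [NormedAddCommGroup F] [NormedSpace ℝ F]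

/-- A map that is smooth near `a` and has an invertible derivative at `a` is a local
diffeomorphism. -/
theorem exists_openPartialHomeomorph_contDiff {f : E → F} {a : E} {f' : E ≃L[ℝ] F}
    (hf : ∀ᶠ x in 𝓝 a, ContDiffAt ℝ ∞ f x) (hf' : HasFDerivAt f (f' : E →L[ℝ] F) a) :
    ∃ e : OpenPartialHomeomorph E F, (⇑e = f) ∧ a ∈ e.source ∧
      (∀ x ∈ e.source, ContDiffAt ℝ ∞ f x ∧ (fderiv ℝ f x).IsInvertible) ∧
      ∀ y ∈ e.target, ContDiffAt ℝ ∞ e.symm y := by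
  have ha : ContDiffAt ℝ ∞ f a := hf.self_of_nhds
  have hne : (∞ : WithTop ℕ∞) ≠ 0 := by simp
  set e₀ := ha.toOpenPartialHomeomorph f hf' hne with he₀
  have hcont : ContinuousAt (fderiv ℝ f) a :=
    (ha.fderiv_right (m := 0) (by simp)).continuousAt
  have hinv : ∀ᶠ x in 𝓝 a, (fderiv ℝ f x).IsInvertible := by
    have h := ContinuousLinearEquiv.nhds f'
    rw [← hf'.fderiv] at h
    filter_upwards [hcont h] with x hx
    exact hx
  obtain ⟨s, hs, hso, has⟩ := eventually_nhds_iff.1 (hf.and hinv)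
  -- The source is shrunk so that smoothness and invertibility hold at all its points, not just at
  -- `a`.
  refine ⟨e₀.restrOpen s hso, rfl, ?_, ?_, ?_⟩
  · rw [OpenPartialHomeomorph.restrOpen_source]
    exact ⟨ha.mem_toOpenPartialHomeomorph_source hf' hne, has⟩
  · intro x hx
    rw [OpenPartialHomeomorph.restrOpen_source] at hx
    exact hs x hx.2
  · intro y hy
    have hx := (e₀.restrOpen s hso).map_target hy
    rw [OpenPartialHomeomorph.restrOpen_source] at hx
    obtain ⟨h1, g, hg⟩ := hs _ hx.2
    refine (e₀.restrOpen s hso).contDiffAt_symm hy (f₀' := g) ?_ h1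
    rw [hg]
    exact (h1.differentiableAt hne).hasFDerivAt

end LocalInverse

/-! ### Composition with a smooth map as a smooth map of spaces of curves -/

namespace ContinuousMap

universe u

variable {K : Type*} [TopologicalSpace K] [CompactSpace K]
  {E : Type u} [NormedAddCommGroup E] [NormedSpace ℝ E]

section

variable (K) (F : Type*) [NormedAddCommGroup F] [NormedSpace ℝ F]

/-- Pointwise application of operators to vectors, for continuous functions on a compact space. -/
noncomputable def pointwiseApply : C(K, E →L[ℝ] F) →L[ℝ] C(K, E) →L[ℝ] C(K, F) :=
  LinearMap.mkContinuous₂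
    (LinearMap.mk₂ ℝ (fun (A : C(K, E →L[ℝ] F)) (h : C(K, E)) =>
        (⟨fun τ => A τ (h τ), A.continuous.clm_apply h.continuous⟩ : C(K, F)))
      (fun _ _ _ => by ext; simp) (fun _ _ _ => by ext; simp)
      (fun _ _ _ => by ext; simp) (fun _ _ _ => by ext; simp)) 1
    (fun A h => by
      rw [ContinuousMap.norm_le _ (by positivity)]
      intro τ
      rw [one_mul]
      exact ((A τ).le_opNorm _).trans
        (mul_le_mul (A.norm_coe_le_norm τ) (h.norm_coe_le_norm τ) (norm_nonneg _)
          (norm_nonneg A)))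

end

/-- The mean value inequality bounds the remainder at each `τ`; uniform continuity of `Dv` makes the
radius `δ` independent of `γ τ`, so the bound holds in sup norm. -/
theorem hasFDerivAt_comp_left {F : Type*} [NormedAddCommGroup F] [NormedSpace ℝ F]
    (v : C(E, F)) (hv : ContDiff ℝ 1 v) (hc : UniformContinuous (fderiv ℝ v)) (γ : C(K, E)) :
    HasFDerivAt (fun γ : C(K, E) => v.comp γ)
      (pointwiseApply K F
        (ContinuousMap.comp ⟨fderiv ℝ v, hv.continuous_fderiv one_ne_zero⟩ γ)) γ := by
  rw [hasFDerivAt_iff_isLittleO, Asymptotics.isLittleO_iff]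
  intro ε hε
  obtain ⟨δ, hδ, h⟩ := Metric.uniformContinuous_iff.1 hc ε hε
  filter_upwards [Metric.ball_mem_nhds γ hδ] with γ' hγ'
  rw [ContinuousMap.norm_le _ (by positivity)]
  intro τ
  have hτ : γ' τ ∈ Metric.ball (γ τ) δ :=
    lt_of_le_of_lt (ContinuousMap.dist_apply_le_dist τ) hγ'
  have key := Convex.norm_image_sub_le_of_norm_fderiv_le' (𝕜 := ℝ) (f := v) (φ := fderiv ℝ v (γ τ))
    (C := ε) (s := Metric.ball (γ τ) δ)
    (fun x _ => (hv.differentiable one_ne_zero).differentiableAt)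
    (fun x hx => by rw [← dist_eq_norm]; exact (h hx).le)
    (convex_ball _ _) (Metric.mem_ball_self hδ) hτ
  refine key.trans ?_
  gcongr
  exact (γ' - γ).norm_coe_le_norm τ

/-- The derivative of composition with `v` is composition with `Dv` followed by a bounded bilinear
pairing. The induction therefore varies the target `F`, and compact support, which passes to `Dv`,
supplies the uniform continuity. -/
theorem contDiff_comp_left_nat (n : ℕ) :
    ∀ {F : Type u} [NormedAddCommGroup F] [NormedSpace ℝ F] (v : C(E, F)), ContDiff ℝ n v →
      HasCompactSupport v → ContDiff ℝ n (fun γ : C(K, E) => v.comp γ) := by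
  induction n with
  | zero =>
    intro F _ _ v _ _
    exact contDiff_zero.2 (ContinuousMap.continuous_postcomp v)
  | succ n ih =>
    intro F _ _ v hv hs
    have h1 : ContDiff ℝ 1 v := hv.of_le (by norm_cast; omega)
    have hd : ContDiff ℝ n (fderiv ℝ v) := hv.fderiv_right (by norm_cast)
    have hsd : HasCompactSupport (fderiv ℝ v) := hs.fderiv ℝ
    have hc : UniformContinuous (fderiv ℝ v) :=
      (h1.continuous_fderiv one_ne_zero).uniformContinuous_of_tendsto_cocompact
        hsd.is_zero_at_infty
    refine contDiff_succ_iff_hasFDerivAt.2 ⟨_, ?_, fun γ => hasFDerivAt_comp_left v h1 hc γ⟩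
    exact (pointwiseApply K F).contDiff.comp
      (ih ⟨fderiv ℝ v, h1.continuous_fderiv one_ne_zero⟩ hd hsd)

theorem contDiff_comp_left {F : Type u} [NormedAddCommGroup F] [NormedSpace ℝ F] (v : C(E, F))
    (hv : ContDiff ℝ ∞ v) (hs : HasCompactSupport v) :
    ContDiff ℝ ∞ (fun γ : C(K, E) => v.comp γ) :=
  contDiff_infty.2 fun n => contDiff_comp_left_nat n v (contDiff_infty.1 hv n) hs

end ContinuousMap

/-! ### Smooth local flows -/

section Flow

open unitInterval

variable {E : Type*} [NormedAddCommGroup E] [NormedSpace ℝ E]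

/-- The primitive, on the whole line, of the extension of a curve on `[0, 1]` by constants. -/
noncomputable def curvePrimitive (h : C(I, E)) (τ : ℝ) : E :=
  ∫ r in (0 : ℝ)..τ, h (projIcc 0 1 zero_le_one r)

theorem continuous_comp_projIcc {E : Type*} [NormedAddCommGroup E] (h : C(I, E)) :
    Continuous fun r : ℝ => h (projIcc 0 1 zero_le_one r) :=
  h.continuous.comp continuous_projIcc

theorem hasDerivAt_curvePrimitive [CompleteSpace E] (h : C(I, E)) (τ : ℝ) :
    HasDerivAt (curvePrimitive h) (h (projIcc 0 1 zero_le_one τ)) τ :=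
  intervalIntegral.integral_hasDerivAt_right ((continuous_comp_projIcc h).intervalIntegrable _ _)
    (continuous_comp_projIcc h).aestronglyMeasurable.stronglyMeasurableAtFilter
    (continuous_comp_projIcc h).continuousAt

theorem norm_curvePrimitive_le (h : C(I, E)) (τ : I) : ‖curvePrimitive h τ‖ ≤ ‖h‖ := by
  have := intervalIntegral.norm_integral_le_of_norm_le_const (a := 0) (b := (τ : ℝ)) (C := ‖h‖)
    (f := fun r => h (projIcc 0 1 zero_le_one r)) (fun r _ => h.norm_coe_le_norm _)
  refine this.trans ?_
  rw [sub_zero, abs_of_nonneg τ.2.1]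
  exact mul_le_of_le_one_right (norm_nonneg _) τ.2.2

/-- The primitive vanishing at `0`, as an operator on curves. -/
noncomputable def primitiveCLM (E : Type*) [NormedAddCommGroup E] [NormedSpace ℝ E]
    [CompleteSpace E] : C(I, E) →L[ℝ] C(I, E) :=
  LinearMap.mkContinuous
    { toFun := fun h => ⟨fun τ => curvePrimitive h τ,
        (continuous_iff_continuousAt.2
          fun τ => (hasDerivAt_curvePrimitive h τ).continuousAt).comp continuous_subtype_val⟩
      map_add' := fun g h => by
        ext τ
        exact intervalIntegral.integral_add ((continuous_comp_projIcc g).intervalIntegrable _ _)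
          ((continuous_comp_projIcc h).intervalIntegrable _ _)
      map_smul' := fun c h => by
        ext τ
        exact intervalIntegral.integral_smul (μ := MeasureTheory.volume) c
          (fun r => h (projIcc 0 1 zero_le_one r)) } 1
    (fun h => by
      rw [ContinuousMap.norm_le _ (by positivity)]
      intro τ
      rw [one_mul]
      exact norm_curvePrimitive_le h τ)

theorem primitiveCLM_apply [CompleteSpace E] (h : C(I, E)) (τ : I) :
    primitiveCLM E h τ = curvePrimitive h τ := rfl

/-- The curve `τ ↦ γ (c τ)`. -/
def rescaleCurve (c : I) (γ : C(I, E)) : C(I, E) :=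
  ⟨fun τ => γ (c * τ), γ.continuous.comp (continuous_const.mul continuous_id)⟩

/-- Substitution `r ↦ c r` in the integral; keeping `c` as a factor on the left covers `c = 0`. It
shows that slowing a solution curve down by `c` solves the integral equation with parameter `c s`.
-/
theorem curvePrimitive_rescale (c : I) (h : C(I, E)) (τ : I) :
    (c : ℝ) • curvePrimitive (rescaleCurve c h) τ = curvePrimitive h (c * τ : I) := by
  have h1 : curvePrimitive (rescaleCurve c h) τ
      = ∫ r in (0 : ℝ)..τ, h (projIcc 0 1 zero_le_one (c * r)) := by
    apply intervalIntegral.integral_congr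
    intro r hr
    rw [uIcc_of_le τ.2.1] at hr
    have hr' : r ∈ Icc (0 : ℝ) 1 := ⟨hr.1, hr.2.trans τ.2.2⟩
    have hc : (c : ℝ) * r ∈ Icc (0 : ℝ) 1 := (c * ⟨r, hr'⟩ : I).2
    simp only [rescaleCurve, ContinuousMap.coe_mk]
    rw [projIcc_of_mem zero_le_one hr', projIcc_of_mem zero_le_one hc]
    rfl
  rw [h1, intervalIntegral.smul_integral_comp_mul_left
    (fun r => h (projIcc 0 1 zero_le_one r)), mul_zero]
  rfl

/-- The map whose zero set (in the last component) consists of the curves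
`γ(τ) = x + s ∫₀^τ v(γ)`. -/
noncomputable def integralEquationMap [CompleteSpace E] (v : C(E, E)) (z : E × ℝ × C(I, E)) :
    E × ℝ × C(I, E) :=
  (z.1, z.2.1, z.2.2 - ContinuousMap.const I z.1 - z.2.1 • primitiveCLM E (v.comp z.2.2))

/-- Constant curves, as a continuous linear map. -/
noncomputable def constCurve (E : Type*) [NormedAddCommGroup E] [NormedSpace ℝ E] :
    E →L[ℝ] C(I, E) :=
  LinearMap.mkContinuous
    { toFun := fun x => ContinuousMap.const I x
      map_add' := fun _ _ => rfl
      map_smul' := fun _ _ => rfl } 1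
    (fun x => by
      rw [ContinuousMap.norm_le _ (by positivity)]
      intro τ
      rw [one_mul]
      rfl)

theorem contDiff_integralEquationMap [CompleteSpace E] (v : C(E, E)) (hv : ContDiff ℝ ∞ v)
    (hs : HasCompactSupport v) : ContDiff ℝ ∞ (integralEquationMap v) := by
  have h1 : ContDiff ℝ ∞ fun z : E × ℝ × C(I, E) => v.comp z.2.2 :=
    (ContinuousMap.contDiff_comp_left v hv hs).comp (contDiff_snd.comp contDiff_snd)
  refine contDiff_fst.prodMk ((contDiff_fst.comp contDiff_snd).prodMk ?_)
  exact ((contDiff_snd.comp contDiff_snd).sub ((constCurve E).contDiff.comp contDiff_fst)).sub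
    ((contDiff_fst.comp contDiff_snd).smul ((primitiveCLM E).contDiff.comp h1))

/-- The shear `(x, s, γ) ↦ (x, s, γ - x - s w)`. -/
noncomputable def curveShear (w : C(I, E)) : (E × ℝ × C(I, E)) ≃L[ℝ] E × ℝ × C(I, E) :=
  ContinuousLinearEquiv.equivOfInverse
    ((ContinuousLinearMap.fst ℝ E (ℝ × C(I, E))).prod
      (((ContinuousLinearMap.fst ℝ ℝ C(I, E)).comp (ContinuousLinearMap.snd ℝ E _)).prod
        ((ContinuousLinearMap.snd ℝ ℝ C(I, E)).comp (ContinuousLinearMap.snd ℝ E _)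
          - (constCurve E).comp (ContinuousLinearMap.fst ℝ E (ℝ × C(I, E)))
          - ((ContinuousLinearMap.fst ℝ ℝ C(I, E)).comp
              (ContinuousLinearMap.snd ℝ E _)).smulRight w)))
    ((ContinuousLinearMap.fst ℝ E (ℝ × C(I, E))).prod
      (((ContinuousLinearMap.fst ℝ ℝ C(I, E)).comp (ContinuousLinearMap.snd ℝ E _)).prod
        ((ContinuousLinearMap.snd ℝ ℝ C(I, E)).comp (ContinuousLinearMap.snd ℝ E _)
          + (constCurve E).comp (ContinuousLinearMap.fst ℝ E (ℝ × C(I, E)))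
          + ((ContinuousLinearMap.fst ℝ ℝ C(I, E)).comp
              (ContinuousLinearMap.snd ℝ E _)).smulRight w)))
    (fun z => Prod.ext rfl (Prod.ext rfl (by simp; abel)))
    (fun z => Prod.ext rfl (Prod.ext rfl (by simp; abel)))

/-- At `s = 0` the term `s ∫ v(γ)` varies to first order only through `s`, so the derivative is a
shear and is invertible whatever `v` is. -/
theorem hasFDerivAt_integralEquationMap [CompleteSpace E] (v : C(E, E)) (hv : ContDiff ℝ ∞ v)
    (hs : HasCompactSupport v) (p : E) :
    HasFDerivAt (integralEquationMap v)
      (curveShear (primitiveCLM E (v.comp (ContinuousMap.const I p))) :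
        (E × ℝ × C(I, E)) →L[ℝ] E × ℝ × C(I, E)) (p, 0, ContinuousMap.const I p) := by
  have hq : DifferentiableAt ℝ (fun z : E × ℝ × C(I, E) => primitiveCLM E (v.comp z.2.2))
      (p, 0, ContinuousMap.const I p) :=
    ((primitiveCLM E).contDiff.comp ((ContinuousMap.contDiff_comp_left v hv hs).comp
      (contDiff_snd.comp contDiff_snd))).differentiable (by simp) _
  have h1 := (hasFDerivAt_fst (𝕜 := ℝ) (E := E) (F := ℝ × C(I, E))
    (p := (p, 0, ContinuousMap.const I p)))
  have h2 := (hasFDerivAt_snd (𝕜 := ℝ) (E := E) (F := ℝ × C(I, E))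
    (p := (p, 0, ContinuousMap.const I p)))
  have h3 := h2.fst
  have h4 := h2.snd
  have h5 := h3.smul hq.hasFDerivAt
  have h6 := h1.prodMk (h3.prodMk ((h4.sub ((constCurve E).hasFDerivAt.comp _ h1)).sub h5))
  refine h6.congr_fderiv ?_
  ext z <;> simp [curveShear]

/-- A smooth compactly supported vector field has a smooth local flow near every point. -/
theorem exists_smooth_flow_of_hasCompactSupport [CompleteSpace E] {v : E → E}
    (hv : ContDiff ℝ ∞ v) (hs : HasCompactSupport v) (p : E) :
    ∃ φ : ℝ × E → E, ∀ᶠ z in 𝓝 ((0 : ℝ), p), ContDiffAt ℝ ∞ φ z ∧ φ (0, z.2) = z.2 ∧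
      fderiv ℝ φ z (1, 0) = v (φ z) := by
  set vc : C(E, E) := ⟨v, hv.continuous⟩ with hvc
  obtain ⟨e, he, hmem, -, hsymm⟩ := exists_openPartialHomeomorph_contDiff
    (Filter.Eventually.of_forall fun z => (contDiff_integralEquationMap vc hv hs).contDiffAt)
    (hasFDerivAt_integralEquationMap vc hv hs p)
  have hval : e (p, 0, ContinuousMap.const I p) = (p, 0, 0) := by
    rw [he]; simp [integralEquationMap]
  have hmem' : (p, (0 : ℝ), (0 : C(I, E))) ∈ e.target := hval ▸ e.map_source hmem
  set ι : ℝ × E → E × ℝ × C(I, E) := fun z => (z.2, z.1, 0) with hι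
  have hιs : ContDiff ℝ ∞ ι := contDiff_snd.prodMk (contDiff_fst.prodMk contDiff_const)
  set ψ : ℝ × E → C(I, E) := fun z => (e.symm (ι z)).2.2 with hψ
  have hψs : ∀ z, ι z ∈ e.target → ContDiffAt ℝ ∞ ψ z := fun z hz =>
    contDiffAt_snd.comp z (contDiffAt_snd.comp z ((hsymm _ hz).comp z hιs.contDiffAt))
  have hψ0 : ψ (0, p) = ContinuousMap.const I p := by
    have := e.left_inv hmem
    rw [hval] at this
    simp [hψ, hι, this]
  obtain ⟨r, hr, hball⟩ := Metric.isOpen_iff.1 e.open_source _ hmem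
  have hev : ∀ᶠ z in 𝓝 ((0 : ℝ), p), ι z ∈ e.target ∧ ψ z ∈ Metric.ball (ψ (0, p)) r ∧
      dist z (0, p) < r :=
    (hιs.continuous.continuousAt.eventually (e.open_target.mem_nhds hmem')).and
      (((hψs _ hmem').continuousAt.eventually (Metric.ball_mem_nhds _ hr)).and
        (Metric.ball_mem_nhds _ hr))
  obtain ⟨δ, hδ, hδb⟩ := Metric.eventually_nhds_iff.1 hev
  have hfix : ∀ z, dist z (0, p) < δ →
      ψ z = ContinuousMap.const I z.2 + z.1 • primitiveCLM E (vc.comp (ψ z)) := by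
    intro z hz
    have h := e.right_inv (hδb hz).1
    rw [he] at h
    simp only [integralEquationMap, hι, Prod.mk.injEq] at h
    obtain ⟨h1, h2, h3⟩ := h
    rw [h1, h2, sub_sub, sub_eq_zero] at h3
    exact h3
  -- The rescaled curve solves the equation with parameter `c s` and stays in the source of `e`,
  -- where injectivity identifies it with `ψ (c s, x)`.
  have hresc : ∀ (c : I) (s : ℝ) (x : E), dist (s, x) (0, p) < δ →
      ψ ((c : ℝ) * s, x) = rescaleCurve c (ψ (s, x)) := by
    intro c s x hz
    obtain ⟨h1, h2, h3⟩ := hδb hz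
    have hsrc : (x, (c : ℝ) * s, rescaleCurve c (ψ (s, x))) ∈ e.source := by
      apply hball
      rw [Metric.mem_ball, Prod.dist_eq, max_lt_iff, Prod.dist_eq, max_lt_iff]
      rw [Prod.dist_eq, max_lt_iff] at h3
      refine ⟨h3.2, ?_, ?_⟩
      · refine lt_of_le_of_lt ?_ h3.1
        simp only [dist_zero_right, norm_mul, Real.norm_eq_abs, abs_of_nonneg c.2.1]
        exact mul_le_of_le_one_left (abs_nonneg _) c.2.2
      · rw [hψ0, Metric.mem_ball, ContinuousMap.dist_lt_iff hr] at h2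
        rw [ContinuousMap.dist_lt_iff hr]
        exact fun τ => h2 (c * τ)
    have hz' : e (x, (c : ℝ) * s, rescaleCurve c (ψ (s, x))) = ι ((c : ℝ) * s, x) := by
      rw [he]
      simp only [integralEquationMap, hι, Prod.mk.injEq, true_and]
      rw [sub_sub, sub_eq_zero]
      ext τ
      have h4 := congrArg (fun γ : C(I, E) => γ (c * τ)) (hfix _ hz)
      simp only [ContinuousMap.add_apply, ContinuousMap.smul_apply, ContinuousMap.const_apply,
        primitiveCLM_apply] at h4 ⊢
      rw [← curvePrimitive_rescale] at h4
      refine h4.trans ?_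
      rw [mul_comm (c : ℝ) s, mul_smul]
      rfl
    have := e.left_inv hsrc
    rw [hz'] at this
    simp [hψ, this]
  refine ⟨fun z => ψ z 1, ?_⟩
  have hdiff : ∀ z, dist z (0, p) < δ → ContDiffAt ℝ ∞ (fun z => ψ z 1) z := fun z hz =>
    (ContinuousMap.evalCLM (M := E) ℝ (1 : I)).contDiff.contDiffAt.comp z (hψs z (hδb hz).1)
  filter_upwards [Metric.ball_mem_nhds _ (half_pos hδ)] with z hz
  have hzδ : dist z (0, p) < δ := lt_trans hz (half_lt_self hδ)
  rw [Metric.mem_ball, Prod.dist_eq, max_lt_iff] at hz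
  refine ⟨hdiff z hzδ, ?_, ?_⟩
  · have h0 : dist ((0 : ℝ), z.2) (0, p) < δ := by
      rw [Prod.dist_eq, max_lt_iff]
      exact ⟨by simpa using hδ, hz.2.trans (half_lt_self hδ)⟩
    have h1 := congrArg (fun γ : C(I, E) => γ 1) (hfix _ h0)
    simpa using h1
  · obtain ⟨s, x⟩ := z
    simp only at hz hzδ ⊢
    -- Since `s` may be zero, the derivative in `s` is read off along `c ↦ c s₀` with a fixed
    -- nonzero `s₀`, and `s₀` is cancelled at the end.
    obtain ⟨s₀, hs₀, hs₀δ, c, hc, hcs⟩ : ∃ s₀ : ℝ, s₀ ≠ 0 ∧ |s₀| = δ / 2 ∧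
        ∃ c ∈ Icc (0 : ℝ) 1, c * s₀ = s := by
      rw [Real.dist_eq, sub_zero] at hz
      rcases le_total 0 s with h | h
      · rw [abs_of_nonneg h] at hz
        exact ⟨δ / 2, (half_pos hδ).ne', abs_of_pos (half_pos hδ), s / (δ / 2),
          ⟨by positivity, (div_le_one (half_pos hδ)).2 hz.1.le⟩, by field_simp⟩
      · rw [abs_of_nonpos h] at hz
        refine ⟨-(δ / 2), by linarith, by rw [abs_neg, abs_of_pos (half_pos hδ)], (-s) / (δ / 2),
          ⟨div_nonneg (by linarith) (by linarith), (div_le_one (half_pos hδ)).2 hz.1.le⟩, ?_⟩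
        field_simp
    have hs₀x : dist (s₀, x) (0, p) < δ := by
      rw [Prod.dist_eq, max_lt_iff, Real.dist_eq, sub_zero, hs₀δ]
      exact ⟨half_lt_self hδ, hz.2.trans (half_lt_self hδ)⟩
    set h := vc.comp (ψ (s₀, x)) with hh
    have hcurve : ∀ c' ∈ Icc (0 : ℝ) 1, ψ (c' * s₀, x) 1 = x + s₀ • curvePrimitive h c' := by
      intro c' hc'
      have h1 := hresc ⟨c', hc'⟩ s₀ x hs₀x
      simp only at h1
      rw [h1]
      have h2 := congrArg (fun γ : C(I, E) => γ (⟨c', hc'⟩ * 1)) (hfix _ hs₀x)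
      refine h2.trans ?_
      simp only [mul_one, ContinuousMap.add_apply, ContinuousMap.smul_apply,
        ContinuousMap.const_apply, primitiveCLM_apply, hh]
    have hψc : h (projIcc 0 1 zero_le_one c) = v (ψ (s, x) 1) := by
      rw [projIcc_of_mem zero_le_one hc, ← hcs]
      have h1 := hresc ⟨c, hc⟩ s₀ x hs₀x
      simp only at h1
      rw [h1]
      simp [hh, rescaleCurve, hvc]
    have hd1 : HasDerivWithinAt (fun c' : ℝ => ψ (c' * s₀, x) 1) (s₀ • v (ψ (s, x) 1))
        (Icc 0 1) c := by
      have h1 := ((hasDerivAt_curvePrimitive h c).const_smul s₀).const_add x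
      rw [hψc] at h1
      exact h1.hasDerivWithinAt.congr hcurve (hcurve c hc)
    have hd2 : HasDerivAt (fun c' : ℝ => ψ (c' * s₀, x) 1)
        (fderiv ℝ (fun z => ψ z 1) (s, x) (s₀, 0)) c := by
      have h1 : HasDerivAt (fun c' : ℝ => (c' * s₀, x)) (s₀, 0) c :=
        (by simpa using (hasDerivAt_id c).mul_const s₀ : HasDerivAt (fun c' => c' * s₀) s₀ c).prodMk
          (hasDerivAt_const c x)
      have h2 : HasFDerivAt (fun z => ψ z 1) (fderiv ℝ (fun z => ψ z 1) (s, x)) (c * s₀, x) := by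
        rw [hcs]
        exact ((hdiff _ hzδ).differentiableAt (by simp)).hasFDerivAt
      exact h2.comp_hasDerivAt c h1
    -- The integral formula is known only for parameters in `[0, 1]`, so derivatives are compared
    -- within that interval.
    have heq := (uniqueDiffOn_Icc zero_lt_one c hc).eq_deriv _ hd2.hasDerivWithinAt hd1
    have hsm : ((s₀, 0) : ℝ × E) = s₀ • (1, 0) := by simp
    rw [hsm, map_smul] at heq
    exact smul_right_injective E hs₀ heq

/-- A vector field that is smooth near `p` has a smooth local flow near `p`. -/
theorem exists_smooth_flow [FiniteDimensional ℝ E] {v : E → E} {p : E}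
    (hv : ∀ᶠ x in 𝓝 p, ContDiffAt ℝ ∞ v x) :
    ∃ φ : ℝ × E → E, ∀ᶠ z in 𝓝 ((0 : ℝ), p), ContDiffAt ℝ ∞ φ z ∧ φ (0, z.2) = z.2 ∧
      fderiv ℝ φ z (1, 0) = v (φ z) := by
  have : CompleteSpace E := FiniteDimensional.complete ℝ E
  obtain ⟨r, hr, hrv⟩ := Metric.eventually_nhds_iff.1 hv
  -- The cutoff is supported inside the ball where `v` is smooth and equals `1` near `p`, where the
  -- flow stays for short times.
  let χ : ContDiffBump p := ⟨r / 4, r / 2, by positivity, by linarith⟩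
  have hχv : ContDiff ℝ ∞ (fun x => χ x • v x) := by
    rw [contDiff_iff_contDiffAt]
    intro x
    by_cases hx : dist x p < r
    · exact χ.contDiff.contDiffAt.smul (hrv hx)
    · have h0 : (fun x => χ x • v x) =ᶠ[𝓝 x] fun _ => 0 := by
        have : x ∉ tsupport χ := by
          rw [χ.tsupport_eq, Metric.mem_closedBall]
          simp only [χ]
          linarith
        filter_upwards [notMem_tsupport_iff_eventuallyEq.1 this] with y hy
        simp [hy]
      exact contDiffAt_const.congr_of_eventuallyEq h0
  have hsupp : HasCompactSupport (fun x => χ x • v x) := χ.hasCompactSupport.smul_right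
  obtain ⟨φ, hφ⟩ := exists_smooth_flow_of_hasCompactSupport hχv hsupp p
  refine ⟨φ, ?_⟩
  have h0 := hφ.self_of_nhds
  have hφp : φ (0, p) = p := h0.2.1
  have hnear : ∀ᶠ z in 𝓝 ((0 : ℝ), p), χ (φ z) = 1 := by
    refine h0.1.continuousAt.eventually (p := fun y => χ y = 1) ?_
    rw [hφp]
    exact χ.eventuallyEq_one
  filter_upwards [hφ, hnear] with z hz h1
  exact ⟨hz.1, hz.2.1, by rw [hz.2.2, h1, one_smul]⟩

end Flow

/-! ### Straightening of vector fields -/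

section Straightening

variable {E : Type*} [NormedAddCommGroup E] [NormedSpace ℝ E] [FiniteDimensional ℝ E]

/-- The map `y ↦ y - η(y) v₀`, a projection along `v₀` when `η(v₀) = 1`. -/
noncomputable def projAlong {E : Type*} [NormedAddCommGroup E] [NormedSpace ℝ E]
    (η : E →L[ℝ] ℝ) (v₀ : E) : E →L[ℝ] E :=
  ContinuousLinearMap.id ℝ E - η.smulRight v₀

@[simp]
theorem projAlong_apply {E : Type*} [NormedAddCommGroup E] [NormedSpace ℝ E]
    (η : E →L[ℝ] ℝ) (v₀ y : E) : projAlong η v₀ y = y - η y • v₀ := by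
  simp [projAlong]

/-- **Flow box theorem**: near a point where it does not vanish, a smooth vector field is constant
in suitable coordinates, whose Jacobian at the point is the identity. -/
theorem exists_flowBox {v : E → E} {p : E} (hv : ∀ᶠ x in 𝓝 p, ContDiffAt ℝ ∞ v x)
    (hp : v p ≠ 0) :
    ∃ e : OpenPartialHomeomorph E E, 0 ∈ e.source ∧ e 0 = p ∧
      (∀ y ∈ e.source, ContDiffAt ℝ ∞ e y ∧ (fderiv ℝ e y).IsInvertible) ∧
      (∀ q ∈ e.target, ContDiffAt ℝ ∞ e.symm q) ∧
      HasFDerivAt e (ContinuousLinearMap.id ℝ E) 0 ∧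
      ∀ᶠ y in 𝓝 0, fderiv ℝ e y (v p) = v (e y) := by
  have : CompleteSpace E := FiniteDimensional.complete ℝ E
  obtain ⟨η, hη⟩ := SeparatingDual.exists_eq_one (R := ℝ) hp
  obtain ⟨φ, hφ⟩ := exists_smooth_flow hv
  -- The chart sends `y` to the point reached after time `η y` from the hyperplane `p + ker η`,
  -- which is transversal to `v p`.
  set ι : E → ℝ × E := fun y => (η y, p + projAlong η (v p) y) with hι
  have hι' : ∀ y, HasFDerivAt ι (η.prod (projAlong η (v p))) y := fun y =>
    η.hasFDerivAt.prodMk ((projAlong η (v p)).hasFDerivAt.const_add p)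
  have hιs : ContDiff ℝ ∞ ι :=
    η.contDiff.prodMk (contDiff_const.add (projAlong η (v p)).contDiff)
  have hι0 : ι 0 = (0, p) := by simp [hι]
  have hev : ∀ᶠ y in 𝓝 (0 : E), ContDiffAt ℝ ∞ φ (ι y) ∧ φ (0, (ι y).2) = (ι y).2 ∧
      fderiv ℝ φ (ι y) (1, 0) = v (φ (ι y)) := by
    have h : Filter.Tendsto ι (𝓝 0) (𝓝 (0, p)) := hι0 ▸ hιs.continuous.continuousAt
    exact h.eventually hφ
  have hφ0 := hφ.self_of_nhds
  have hφp : φ (0, p) = p := hφ0.2.1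
  have hφd : HasFDerivAt φ (fderiv ℝ φ (0, p)) (0, p) :=
    (hφ0.1.differentiableAt (by simp)).hasFDerivAt
  have hd0 : ∀ h : E, fderiv ℝ φ (0, p) (0, h) = h := by
    intro h
    have h1 : HasFDerivAt (fun x : E => φ (0, x))
        ((fderiv ℝ φ (0, p)).comp (ContinuousLinearMap.inr ℝ ℝ E)) p :=
      hφd.comp p (hasFDerivAt_prodMk_right (0 : ℝ) p)
    have h2 : (fun x : E => φ (0, x)) =ᶠ[𝓝 p] id := by
      have hc : Filter.Tendsto (fun x : E => ((0 : ℝ), x)) (𝓝 p) (𝓝 (0, p)) :=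
        (continuous_const.prodMk continuous_id).continuousAt
      filter_upwards [hc.eventually hφ] with x hx using hx.2.1
    have h3 := h1.unique ((hasFDerivAt_id p).congr_of_eventuallyEq h2)
    simpa using congrArg (fun L : E →L[ℝ] E => L h) h3
  have hcomp : HasFDerivAt (φ ∘ ι)
      ((ContinuousLinearEquiv.refl ℝ E : E ≃L[ℝ] E) : E →L[ℝ] E) 0 := by
    have h1 : HasFDerivAt φ (fderiv ℝ φ (0, p)) (ι 0) := hι0.symm ▸ hφd
    refine (h1.comp 0 (hι' 0)).congr_fderiv ?_
    ext h
    have hsplit : ((η h, h - η h • v p) : ℝ × E) = η h • (1, 0) + (0, h - η h • v p) := by simp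
    have h2 := hφ0.2.2
    rw [hφp] at h2
    simp [hsplit, hd0, h2, -Prod.smul_mk, -Prod.mk_add_mk]
  have hsm : ∀ᶠ y in 𝓝 (0 : E), ContDiffAt ℝ ∞ (φ ∘ ι) y := by
    filter_upwards [hev] with y hy using hy.1.comp y hιs.contDiffAt
  obtain ⟨e, he, h0, hsrc, htgt⟩ := exists_openPartialHomeomorph_contDiff hsm hcomp
  refine ⟨e, h0, ?_, ?_, htgt, ?_, ?_⟩
  · rw [he, Function.comp_apply, hι0, hφp]
  · rwa [he]
  · rw [he]; exact hcomp
  · rw [he]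
    filter_upwards [hev] with y hy
    have h1 := ((hy.1.differentiableAt (by simp)).hasFDerivAt).comp y (hι' y)
    rw [h1.fderiv, Function.comp_apply, ← hy.2.2]
    simp [hη]

theorem OpenPartialHomeomorph.fderiv_symm_apply_fderiv {E : Type*} [NormedAddCommGroup E]
    [NormedSpace ℝ E] (e : OpenPartialHomeomorph E E) {y : E} (hy : y ∈ e.source)
    (he : DifferentiableAt ℝ e y) (hs : DifferentiableAt ℝ e.symm (e y)) (h : E) :
    fderiv ℝ e.symm (e y) (fderiv ℝ e y h) = h := by
  have h1 := hs.hasFDerivAt.comp y he.hasFDerivAt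
  have h2 : e.symm ∘ e =ᶠ[𝓝 y] id := by
    filter_upwards [e.open_source.mem_nhds hy] with x hx using e.left_inv hx
  have h3 := h1.unique ((hasFDerivAt_id y).congr_of_eventuallyEq h2)
  exact congrArg (fun L : E →L[ℝ] E => L h) h3

/-- A smooth function with prescribed differential at a point and constant derivative along a
nonvanishing vector field. -/
theorem exists_fderiv_apply_eq_const {v : E → E} {p : E} (hv : ∀ᶠ x in 𝓝 p, ContDiffAt ℝ ∞ v x)
    (hp : v p ≠ 0) (l : E →L[ℝ] ℝ) :
    ∃ f : E → ℝ, HasFDerivAt f l p ∧ f p = 0 ∧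
      ∀ᶠ q in 𝓝 p, ContDiffAt ℝ ∞ f q ∧ fderiv ℝ f q (v q) = l (v p) := by
  obtain ⟨e, h0, he0, hsrc, htgt, hid, hev⟩ := exists_flowBox hv hp
  have hpt : p ∈ e.target := he0 ▸ e.map_source h0
  have hsp : e.symm p = 0 := by rw [← he0, e.left_inv h0]
  have hsd : ∀ q ∈ e.target, HasFDerivAt e.symm (fderiv ℝ e.symm q) q := fun q hq =>
    ((htgt q hq).differentiableAt (by simp)).hasFDerivAt
  have hfs : ∀ y ∈ e.source, ∀ h, fderiv ℝ e.symm (e y) (fderiv ℝ e y h) = h := fun y hy h =>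
    e.fderiv_symm_apply_fderiv hy ((hsrc y hy).1.differentiableAt (by simp))
      (hsd _ (e.map_source hy)).differentiableAt h
  refine ⟨fun q => l (e.symm q), ?_, by simp [hsp], ?_⟩
  · refine (l.hasFDerivAt.comp p (hsd p hpt)).congr_fderiv ?_
    ext h
    have := hfs 0 h0 h
    rw [he0, hid.fderiv] at this
    simpa using congrArg l this
  · have hc : Filter.Tendsto e.symm (𝓝 p) (𝓝 0) := hsp ▸ (hsd p hpt).continuousAt
    filter_upwards [e.open_target.mem_nhds hpt, hc.eventually hev] with q hq hq'
    refine ⟨l.contDiff.contDiffAt.comp q (htgt q hq), ?_⟩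
    have hfd : HasFDerivAt (fun q => l (e.symm q)) _ q := l.hasFDerivAt.comp q (hsd q hq)
    rw [hfd.fderiv]
    have h1 := hfs _ (e.map_target hq) (v p)
    rw [hq', e.right_inv hq] at h1
    simp [h1]

/-- A smooth function with prescribed differential `l` at a point that is invariant along `v` and
has constant derivative along `w`, when `[v, w]` is a multiple of `v` and `l(v(p)) = 0`. -/
theorem exists_fderiv_apply_eq_zero_and_const {v w : E → E} {p : E} {k : E → ℝ}
    (hv : ∀ᶠ x in 𝓝 p, ContDiffAt ℝ ∞ v x) (hw : ∀ᶠ x in 𝓝 p, ContDiffAt ℝ ∞ w x)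
    (hvw : LinearIndependent ℝ ![v p, w p])
    (hbr : ∀ᶠ q in 𝓝 p, VectorField.lieBracket ℝ v w q = k q • v q)
    (l : E →L[ℝ] ℝ) (hl : l (v p) = 0) :
    ∃ f : E → ℝ, HasFDerivAt f l p ∧ f p = 0 ∧
      ∀ᶠ q in 𝓝 p, ContDiffAt ℝ ∞ f q ∧ fderiv ℝ f q (v q) = 0 ∧
        fderiv ℝ f q (w q) = l (w p) := by
  have : CompleteSpace E := FiniteDimensional.complete ℝ E
  have hvp : v p ≠ 0 := hvw.ne_zero 0
  obtain ⟨η, hη⟩ := SeparatingDual.exists_eq_one (R := ℝ) hvp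
  obtain ⟨e, h0, he0, hsrc, htgt, hid, hstr⟩ := exists_flowBox hv hvp
  set v₀ := v p with hv₀
  set P := projAlong η v₀ with hP
  have hPv : P v₀ = 0 := by simp [hP, hη]
  have hPP : ∀ y, P (P y) = P y := fun y => by
    rw [hP, projAlong_apply η v₀ y, map_sub, map_smul, ← hP, hPv, smul_zero, sub_zero, hP,
      projAlong_apply]
  have hlP : ∀ y, l (P y) = l y := fun y => by simp [hP, hl]
  -- In flow box coordinates `v` is the constant `v₀`, and the bracket relation becomes `∂_{v₀} W =
  -- k v₀`. Hence `P W` is constant along `v₀` and descends to the quotient by `v₀`, modelled on the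
  -- range of `P`.
  set W := VectorField.pullback ℝ e w with hW
  have hc : Filter.Tendsto e (𝓝 0) (𝓝 p) := he0 ▸ (hsrc 0 h0).1.continuousAt
  have hsrc' : ∀ᶠ y in 𝓝 (0 : E), y ∈ e.source := e.open_source.mem_nhds h0
  have hWs : ∀ᶠ y in 𝓝 (0 : E), ContDiffAt ℝ ∞ W y := by
    filter_upwards [hsrc', hc.eventually hw] with y hy hwy
    have h1 : ContDiffAt ℝ ∞ (fderiv ℝ e) y := (hsrc y hy).1.fderiv_right (by simp)
    exact ((hsrc y hy).2.contDiffAt_map_inverse.comp y h1).clm_apply (hwy.comp y (hsrc y hy).1)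
  have hVc : ∀ᶠ y in 𝓝 (0 : E), VectorField.pullback ℝ e v y = v₀ := by
    filter_upwards [hsrc', hstr] with y hy hy'
    rw [VectorField.pullback, ← hy', (hsrc y hy).2.inverse_apply_self]
  have hWd : ∀ᶠ y in 𝓝 (0 : E), fderiv ℝ W y v₀ = k (e y) • v₀ := by
    filter_upwards [hsrc', hVc.eventually_nhds, hc.eventually hv, hc.eventually hw,
      hc.eventually hbr] with y hy hVy hvy hwy hby
    have h1 := VectorField.pullback_lieBracket (𝕜 := ℝ) (n := ∞) (f := e) (V := v) (W := w) (x := y)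
      (by simpa using WithTop.coe_le_coe.2 (le_top : (2 : ℕ∞) ≤ ⊤)) (hsrc y hy).1
      (hvy.differentiableAt (by simp)) (hwy.differentiableAt (by simp))
    have h2 : VectorField.pullback ℝ e (VectorField.lieBracket ℝ v w) y
        = k (e y) • VectorField.pullback ℝ e v y := by
      simp only [VectorField.pullback, hby, map_smul]
    have h3 : fderiv ℝ (VectorField.pullback ℝ e v) y = 0 := by
      have : VectorField.pullback ℝ e v =ᶠ[𝓝 y] fun _ => v₀ := hVy
      rw [this.fderiv_eq, fderiv_fun_const]
      rfl
    rw [h2, hVy.self_of_nhds, VectorField.lieBracket, h3, hVy.self_of_nhds] at h1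
    simpa using h1.symm
  obtain ⟨r, hr, hball⟩ := Metric.eventually_nhds_iff_ball.1 (hWs.and hWd)
  have hPc : Filter.Tendsto P (𝓝 0) (𝓝 0) := by simpa using P.continuous.tendsto 0
  -- The segment from `P y` to `y` is parallel to `v₀` and lies in a ball where `P W` has zero
  -- derivative along it.
  have hinv : ∀ᶠ y in 𝓝 (0 : E), P (W (P y)) = P (W y) := by
    filter_upwards [Metric.ball_mem_nhds (0 : E) hr, hPc.eventually (Metric.ball_mem_nhds 0 hr)]
      with y hy hPy
    have hseg : ∀ s ∈ Icc (0 : ℝ) 1, P y + s • η y • v₀ ∈ Metric.ball (0 : E) r := by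
      intro s hs
      have h1 := (convex_ball (0 : E) r).add_smul_sub_mem hPy hy hs
      have h2 : y - P y = η y • v₀ := by simp [hP]
      rwa [h2] at h1
    have hder : ∀ s ∈ Icc (0 : ℝ) 1,
        HasDerivWithinAt (fun s : ℝ => P (W (P y + s • η y • v₀))) 0 (Icc 0 1) s := by
      intro s hs
      obtain ⟨h1, h2⟩ := hball _ (hseg s hs)
      have h3 : HasDerivAt (fun s : ℝ => P y + s • η y • v₀) (η y • v₀) s := by
        simpa using ((hasDerivAt_id s).smul_const (η y • v₀)).const_add (P y)
      have h4 := (P.hasFDerivAt.comp _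
        (h1.differentiableAt (by simp)).hasFDerivAt).comp_hasDerivAt s h3
      refine HasDerivAt.hasDerivWithinAt (h4.congr_deriv ?_)
      simp [h2, hPv, -projAlong_apply]
    have hconst := constant_of_has_deriv_right_zero (a := (0 : ℝ)) (b := 1)
      (f := fun s : ℝ => P (W (P y + s • η y • v₀)))
      (fun s hs => (hder s hs).continuousWithinAt)
      (fun s hs => ((hder s (Ico_subset_Icc_self hs)).mono_of_mem_nhdsWithin
        (Icc_mem_nhdsGE_of_mem hs))) 1 (right_mem_Icc.2 zero_le_one)
    have hy1 : P y + (1 : ℝ) • η y • v₀ = y := by simp [hP]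
    simp only [hy1, zero_smul, add_zero] at hconst
    exact hconst.symm
  set W' : E → E := fun y => P (W (P y)) with hW'
  have hW's : ∀ᶠ y in 𝓝 (0 : E), ContDiffAt ℝ ∞ W' y := by
    filter_upwards [hPc.eventually hWs] with y hy
    exact P.contDiff.contDiffAt.comp y (hy.comp y P.contDiff.contDiffAt)
  have hW0 : W 0 = w p := by
    simp only [hW, VectorField.pullback, hid.fderiv, he0, ContinuousLinearMap.inverse_id]
    rfl
  have hW'0 : W' 0 = P (w p) := by simp only [hW', map_zero, hW0]
  have hne : W' 0 ≠ 0 := by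
    rw [hW'0]
    intro h
    rw [hP, projAlong_apply, sub_eq_zero] at h
    have := (LinearIndependent.pair_iff.1 hvw) (η (w p)) (-1)
      (by rw [neg_one_smul, ← sub_eq_add_neg, sub_eq_zero]; exact h.symm)
    norm_num at this
  -- Solve along the projected field, then precompose with `P`: this kills `v`, and costs nothing on
  -- `w` because `l ∘ P = l`.
  obtain ⟨g, hg, hg0, hgev⟩ := exists_fderiv_apply_eq_const hW's hne l
  have hpt : p ∈ e.target := he0 ▸ e.map_source h0
  have hsp : e.symm p = 0 := by rw [← he0, e.left_inv h0]
  have hsd : ∀ q ∈ e.target, HasFDerivAt e.symm (fderiv ℝ e.symm q) q := fun q hq =>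
    ((htgt q hq).differentiableAt (by simp)).hasFDerivAt
  have hfs : ∀ y ∈ e.source, ∀ h, fderiv ℝ e.symm (e y) (fderiv ℝ e y h) = h := fun y hy h =>
    e.fderiv_symm_apply_fderiv hy ((hsrc y hy).1.differentiableAt (by simp))
      (hsd _ (e.map_source hy)).differentiableAt h
  have hsc : Filter.Tendsto e.symm (𝓝 p) (𝓝 0) := hsp ▸ (hsd p hpt).continuousAt
  refine ⟨fun q => g (P (e.symm q)), ?_, by simp only [hsp, map_zero, hg0], ?_⟩
  · have hg' : HasFDerivAt g l (P (e.symm p)) := by rwa [hsp, map_zero]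
    refine (hg'.comp p (P.hasFDerivAt.comp p (hsd p hpt))).congr_fderiv ?_
    ext h
    have := hfs 0 h0 h
    rw [he0, hid.fderiv] at this
    simp only [ContinuousLinearMap.comp_apply, hlP]
    exact congrArg l this
  · filter_upwards [e.open_target.mem_nhds hpt, hsc.eventually hstr,
      hsc.eventually (hPc.eventually hgev), hsc.eventually hinv] with q hq hq1 hq2 hq3
    have hgd : HasFDerivAt g (fderiv ℝ g (P (e.symm q))) (P (e.symm q)) :=
      (hq2.1.differentiableAt (by simp)).hasFDerivAt
    have hfd : HasFDerivAt (fun q => g (P (e.symm q))) _ q :=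
      hgd.comp q (P.hasFDerivAt.comp q (hsd q hq))
    refine ⟨hq2.1.comp q (P.contDiff.contDiffAt.comp q (htgt q hq)), ?_, ?_⟩
    · have h1 := hfs _ (e.map_target hq) v₀
      rw [hq1, e.right_inv hq] at h1
      rw [hfd.fderiv]
      simp only [ContinuousLinearMap.comp_apply, h1, hPv, map_zero]
    · have h1 := hfs _ (e.map_target hq) (W (e.symm q))
      have h2 : fderiv ℝ e (e.symm q) (W (e.symm q)) = w (e (e.symm q)) :=
        VectorField.fderiv_pullback e w _ (hsrc _ (e.map_target hq)).2
      rw [h2, e.right_inv hq] at h1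
      rw [hfd.fderiv]
      simp only [ContinuousLinearMap.comp_apply, h1]
      have h3 : W' (P (e.symm q)) = P (W (e.symm q)) := by simp only [hW', hPP, hq3]
      rw [← h3, hq2.2, hW'0, hlP]

end Straightening

namespace EvolutionSymmetry

/-! ### Normal forms from adapted coordinate functions -/

theorem contDiffAt_vec3 {f g h : Base → ℝ} {q : Base} (hf : ContDiffAt ℝ ∞ f q)
    (hg : ContDiffAt ℝ ∞ g q) (hh : ContDiffAt ℝ ∞ h q) :
    ContDiffAt ℝ ∞ (fun q => (![f q, g q, h q] : Base)) q := by
  rw [contDiffAt_pi]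
  intro i
  fin_cases i <;> assumption

theorem hasFDerivAt_vec3 {f g h : Base → ℝ} {q : Base} {f' g' h' : Base →L[ℝ] ℝ}
    (hf : HasFDerivAt f f' q) (hg : HasFDerivAt g g' q) (hh : HasFDerivAt h h' q) :
    HasFDerivAt (fun q => (![f q, g q, h q] : Base)) (ContinuousLinearMap.pi ![f', g', h']) q := by
  rw [hasFDerivAt_pi']
  intro i
  fin_cases i
  · exact hf.congr_fderiv (by ext; rfl)
  · exact hg.congr_fderiv (by ext; rfl)
  · exact hh.congr_fderiv (by ext; rfl)

theorem hasFDerivAt_comp_time {τ : ℝ → ℝ} {q : Base} (hτ : DifferentiableAt ℝ τ (q 0)) :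
    HasFDerivAt (fun q : Base => τ (q 0))
      (deriv τ (q 0) • ContinuousLinearMap.proj (R := ℝ) (φ := fun _ : Fin 3 => ℝ) 0) q :=
  hτ.hasDerivAt.comp_hasFDerivAt q (hasFDerivAt_apply (𝕜 := ℝ) (0 : Fin 3) q)

theorem tendsto_time (p : Base) : Filter.Tendsto (fun q : Base => q 0) (𝓝 p) (𝓝 (p 0)) :=
  (continuous_apply 0).continuousAt

/-- Functions `τ(t), X, U` with independent differentials in which the fields `e` take the form
`f` provide an equivalence transformation. -/
theorem exists_isEquivalentOn_of_coordinates {Ω : Set Base} (hΩ : IsOpen Ω) {p : Base} (hp : p ∈ Ω)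
    {e f : Fin 2 → Base → Base} {τ : ℝ → ℝ} {X U : Base → ℝ}
    (hτ : ∀ᶠ s in 𝓝 (p 0), ContDiffAt ℝ ∞ τ s) (hX : ∀ᶠ q in 𝓝 p, ContDiffAt ℝ ∞ X q)
    (hU : ∀ᶠ q in 𝓝 p, ContDiffAt ℝ ∞ U q) (hτ' : deriv τ (p 0) ≠ 0)
    (hinj : ∀ h : Base, h 0 = 0 → fderiv ℝ X p h = 0 → fderiv ℝ U p h = 0 → h = 0)
    (heq : ∀ᶠ q in 𝓝 p, ∀ i,
      ![deriv τ (q 0) * e i q 0, fderiv ℝ X q (e i q), fderiv ℝ U q (e i q)]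
        = f i ![τ (q 0), X q, U q]) :
    ∃ V ⊆ Ω, p ∈ V ∧ IsEquivalentOn V e f := by
  have hne : (∞ : WithTop ℕ∞) ≠ 0 := by simp
  have hτq : ∀ᶠ q : Base in 𝓝 p, ContDiffAt ℝ ∞ τ (q 0) := (tendsto_time p).eventually hτ
  set Φ : Base → Base := fun q => ![τ (q 0), X q, U q] with hΦ
  have hΦs : ∀ᶠ q in 𝓝 p, ContDiffAt ℝ ∞ Φ q := by
    filter_upwards [hτq, hX, hU] with q h1 h2 h3
    exact contDiffAt_vec3 (h1.comp q (contDiff_apply ℝ ℝ (0 : Fin 3)).contDiffAt) h2 h3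
  have hΦd : ∀ᶠ q in 𝓝 p, HasFDerivAt Φ (ContinuousLinearMap.pi
      ![deriv τ (q 0) • ContinuousLinearMap.proj (R := ℝ) (φ := fun _ : Fin 3 => ℝ) 0,
        fderiv ℝ X q, fderiv ℝ U q]) q := by
    filter_upwards [hτq, hX, hU] with q h1 h2 h3
    exact hasFDerivAt_vec3 (hasFDerivAt_comp_time (h1.differentiableAt hne))
      (h2.differentiableAt hne).hasFDerivAt (h3.differentiableAt hne).hasFDerivAt
  have hdp := hΦd.self_of_nhds
  have hker : Function.Injective (fderiv ℝ Φ p) := by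
    rw [injective_iff_map_eq_zero]
    intro h hh
    rw [hdp.fderiv] at hh
    have h0 := congrFun hh 0
    have h1 := congrFun hh 1
    have h2 := congrFun hh 2
    simp [hτ'] at h0 h1 h2
    exact hinj h h0 h1 h2
  have heqv : HasFDerivAt Φ ((LinearEquiv.ofInjectiveEndo (fderiv ℝ Φ p : Base →ₗ[ℝ] Base)
      hker).toContinuousLinearEquiv : Base →L[ℝ] Base) p := by
    refine hdp.congr_fderiv ?_
    rw [← hdp.fderiv]
    ext1 h
    rfl
  obtain ⟨E, hE, hpE, hsrc, -⟩ := exists_openPartialHomeomorph_contDiff hΦs heqv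
  have hτe : HasFDerivAt τ _ (p 0) :=
    ((hτ.self_of_nhds.differentiableAt hne).hasDerivAt).hasFDerivAt_equiv hτ'
  -- A separate local inverse of `τ` is needed because an equivalence transformation must be
  -- injective in time on the whole projection of `V`.
  obtain ⟨S, hS, hpS, -, -⟩ := exists_openPartialHomeomorph_contDiff hτ hτe
  obtain ⟨W, hW, hWo, hpW⟩ := eventually_nhds_iff.1 (hΦd.and heq)
  refine ⟨(Ω ∩ E.source) ∩ ((fun q : Base => q 0) ⁻¹' S.source ∩ W), fun q hq => hq.1.1,
    ⟨⟨hp, hpE⟩, hpS, hpW⟩, Φ, ⟨?_, ?_, ?_, ?_, ?_⟩, 1, by simp, ?_⟩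
  · exact (hΩ.inter E.open_source).inter
      ((S.open_source.preimage (continuous_apply 0)).inter hWo)
  · exact fun q hq => (hsrc q hq.1.2).1.contDiffWithinAt
  · intro q hq q' hq' h
    rw [← hE] at h
    exact E.injOn hq.1.2 hq'.1.2 h
  · intro q hq
    obtain ⟨g, hg⟩ := (hsrc q hq.1.2).2
    rw [← hg]
    exact (LinearEquiv.isUnit_det' g.toLinearEquiv).ne_zero
  · refine ⟨τ, ?_, fun q _ => rfl⟩
    rintro _ ⟨q, hq, rfl⟩ _ ⟨q', hq', rfl⟩ h
    have h' : S (q 0) = S (q' 0) := by rw [hS]; exact h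
    exact S.injOn hq.2.1 hq'.2.1 h'
  · intro q hq i
    obtain ⟨h1, h2⟩ := hW q hq.2.2
    have h3 : ∑ j, (1 : Matrix (Fin 2) (Fin 2) ℝ) i j • f j (Φ q) = f i (Φ q) := by
      fin_cases i <;> simp [Matrix.one_apply]
    rw [h3, h1.fderiv]
    simp only [hΦ]
    rw [← h2 i]
    ext j
    fin_cases j <;> simp

/-! ### Linear functionals on `ℝ³` -/

/-- Completion to a basis. The functionals prescribe differentials of coordinate functions; the
decomposition is used to check that these differentials have no common kernel. -/
theorem exists_third_vector {v w : Base} (h : LinearIndependent ℝ ![v, w]) :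
    ∃ z : Base, (∀ y : Base, ∃ a b c : ℝ, y = a • v + b • w + c • z) ∧
      ∀ α β γ : ℝ, ∃ l : Base →L[ℝ] ℝ, l v = α ∧ l w = β ∧ l z = γ := by
  obtain ⟨z, hz⟩ := exists_linearIndependent_snoc_of_lt_finrank h (by simp)
  have hcard : Fintype.card (Fin 3) = Module.finrank ℝ Base := by simp
  set B : Module.Basis (Fin 3) ℝ Base := basisOfLinearIndependentOfCardEqFinrank hz hcard with hB
  have h0 : B 0 = v := by rw [hB, coe_basisOfLinearIndependentOfCardEqFinrank]; rfl
  have h1 : B 1 = w := by rw [hB, coe_basisOfLinearIndependentOfCardEqFinrank]; rfl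
  have h2 : B 2 = z := by rw [hB, coe_basisOfLinearIndependentOfCardEqFinrank]; rfl
  refine ⟨z, fun y => ⟨B.repr y 0, B.repr y 1, B.repr y 2, ?_⟩, fun α β γ =>
    ⟨(B.constr ℝ ![α, β, γ]).toContinuousLinearMap, ?_, ?_, ?_⟩⟩
  · have h := B.sum_repr y
    rw [Fin.sum_univ_three, h0, h1, h2] at h
    exact h.symm
  · rw [← h0]; simp
  · rw [← h1]; simp
  · rw [← h2]; simp

/-! ### Adapted coordinates for a nonabelian pair of fields -/

/-- A function `X` with `e₁ X = 1` and `e₂ X = X`, given a function `S` with `e₁ S = 0` and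
`e₂ S = S`. -/
theorem exists_adapted_coordinate {e : Fin 2 → Base → Base} {p : Base}
    (he : ∀ i, ∀ᶠ q in 𝓝 p, ContDiffAt ℝ ∞ (e i) q)
    (hbr : ∀ᶠ q in 𝓝 p, VectorField.lieBracket ℝ (e 0) (e 1) q = e 0 q)
    (hli : LinearIndependent ℝ ![e 0 p, e 1 p]) {S : Base → ℝ}
    (hS : ∀ᶠ q in 𝓝 p, ContDiffAt ℝ ∞ S q ∧ fderiv ℝ S q (e 0 q) = 0 ∧
      fderiv ℝ S q (e 1 q) = S q) (hSp : S p ≠ 0) :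
    ∃ X : Base → ℝ, ∀ᶠ q in 𝓝 p, ContDiffAt ℝ ∞ X q ∧ fderiv ℝ X q (e 0 q) = 1 ∧
      fderiv ℝ X q (e 1 q) = X q := by
  have hne : (∞ : WithTop ℕ∞) ≠ 0 := by simp
  set v : Base → Base := fun q => S q • e 0 q with hv
  have hvs : ∀ᶠ q in 𝓝 p, ContDiffAt ℝ ∞ v q := by
    filter_upwards [hS, he 0] with q h1 h2 using h1.1.smul h2
  -- `[e₂, S e₁] = (e₂ S) e₁ - S e₁ = 0`, so one can solve `e₂ Y = 0`, `S e₁ Y = 1`; then `X = S Y`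
  -- works.
  have hb : ∀ᶠ q in 𝓝 p, VectorField.lieBracket ℝ (e 1) v q = (0 : ℝ) • e 1 q := by
    filter_upwards [hS, he 0, hbr] with q h1 h2 h3
    rw [hv, VectorField.lieBracket_smul_right (h1.1.differentiableAt hne)
      (h2.differentiableAt hne), VectorField.lieBracket_swap, h3, h1.2.2]
    simp
  have hli' : LinearIndependent ℝ ![e 1 p, v p] := by
    rw [LinearIndependent.pair_iff] at hli ⊢
    intro a b hab
    have := hli (b * S p) a (by rw [mul_smul, add_comm]; exact hab)
    exact ⟨this.2, (mul_eq_zero.1 this.1).resolve_right hSp⟩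
  obtain ⟨z, -, hz⟩ := exists_third_vector hli'
  obtain ⟨l, hl1, hl2, -⟩ := hz 0 1 0
  obtain ⟨Y, -, -, hY⟩ := exists_fderiv_apply_eq_zero_and_const (k := fun _ => 0) (he 1) hvs hli' hb
    l hl1
  refine ⟨fun q => S q * Y q, ?_⟩
  filter_upwards [hS, hY] with q h1 h2
  have h3 : HasFDerivAt (fun q => S q * Y q) _ q :=
    (h1.1.differentiableAt hne).hasFDerivAt.mul (h2.1.differentiableAt hne).hasFDerivAt
  have h4 := h2.2.2
  rw [hl2, hv, map_smul, smul_eq_mul] at h4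
  refine ⟨h1.1.mul h2.1, ?_, ?_⟩
  · rw [h3.fderiv]
    simp [h1.2.1, h4]
  · rw [h3.fderiv]
    simp [h1.2.2, h2.2.1, mul_comm]

theorem hasFDerivAt_exp_comp {Z : Base → ℝ} {q : Base} (h : ContDiffAt ℝ ∞ Z q) :
    HasFDerivAt (fun q => Real.exp (Z q)) (Real.exp (Z q) • fderiv ℝ Z q) q :=
  (h.differentiableAt (by simp)).hasFDerivAt.exp

/-! ### The four normal forms -/

/-- The case of a field `e₁` transversal to the fibres `t = const`, and an algebra of rank two. -/
theorem exists_isEquivalentOn_canonical_zero {Ω : Set Base} (hΩ : IsOpen Ω) {p : Base} (hp : p ∈ Ω)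
    {e : Fin 2 → Base → Base} {τ : ℝ → ℝ}
    (he : ∀ i, ∀ᶠ q in 𝓝 p, ContDiffAt ℝ ∞ (e i) q)
    (hbr : ∀ᶠ q in 𝓝 p, VectorField.lieBracket ℝ (e 0) (e 1) q = e 0 q)
    (hli : LinearIndependent ℝ ![e 0 p, e 1 p])
    (hτ : ∀ᶠ s in 𝓝 (p 0), ContDiffAt ℝ ∞ τ s)
    (hτ0 : ∀ᶠ q in 𝓝 p, deriv τ (q 0) * e 0 q 0 = 1)
    (hτ1 : ∀ᶠ q in 𝓝 p, deriv τ (q 0) * e 1 q 0 = τ (q 0)) :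
    ∃ V ⊆ Ω, p ∈ V ∧ IsEquivalentOn V e (canonical 0) := by
  have hb : ∀ᶠ q in 𝓝 p, VectorField.lieBracket ℝ (e 0) (e 1) q = (1 : ℝ) • e 0 q := by
    simpa using hbr
  obtain ⟨z, hspan, hz⟩ := exists_third_vector hli
  obtain ⟨l, hl0, hl1, -⟩ := hz 0 1 0
  obtain ⟨m, hm0, hm1, hm2⟩ := hz 0 0 1
  -- `e₁ Z = 0` and `e₂ Z = 1`, so `X = exp Z` satisfies `e₁ X = 0` and `e₂ X = X`; `U` is a common
  -- invariant.
  obtain ⟨Z, hZd, -, hZ⟩ :=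
    exists_fderiv_apply_eq_zero_and_const (k := fun _ => 1) (he 0) (he 1) hli hb l hl0
  obtain ⟨U, hUd, -, hU⟩ :=
    exists_fderiv_apply_eq_zero_and_const (k := fun _ => 1) (he 0) (he 1) hli hb m hm0
  have hp0 := hτ0.self_of_nhds
  refine exists_isEquivalentOn_of_coordinates hΩ hp (X := fun q => Real.exp (Z q)) hτ
    (hZ.mono fun q hq => hq.1.exp) (hU.mono fun q hq => hq.1) (left_ne_zero_of_mul_eq_one hp0) ?_ ?_
  · intro h h0 h1 h2
    obtain ⟨a, b, c, rfl⟩ := hspan h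
    rw [hUd.fderiv] at h2
    rw [(hasFDerivAt_exp_comp hZ.self_of_nhds.1).fderiv, hZd.fderiv] at h1
    have hc : c = 0 := by simpa [hm0, hm1, hm2] using h2
    subst hc
    have hb : b = 0 := by simpa [hl0, hl1] using h1
    subst hb
    have ha : a = 0 := by simpa [right_ne_zero_of_mul_eq_one hp0] using h0
    simp [ha]
  · filter_upwards [hτ0, hτ1, hZ, hU] with q h0 h1 h2 h3
    rw [(hasFDerivAt_exp_comp h2.1).fderiv, Fin.forall_fin_two]
    constructor <;> ext j <;> fin_cases j <;>
      simp [canonical, h0, h1, h2.2.1, h2.2.2, h3.2.1, h3.2.2, hl1, hm1]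

/-- The case of a field `e₁` tangent to the fibres `t = const` and a field `e₂` transversal to
them. -/
theorem exists_isEquivalentOn_canonical_one {Ω : Set Base} (hΩ : IsOpen Ω) {p : Base} (hp : p ∈ Ω)
    {e : Fin 2 → Base → Base} {τ : ℝ → ℝ}
    (he : ∀ i, ∀ᶠ q in 𝓝 p, ContDiffAt ℝ ∞ (e i) q)
    (hbr : ∀ᶠ q in 𝓝 p, VectorField.lieBracket ℝ (e 0) (e 1) q = e 0 q)
    (hli : LinearIndependent ℝ ![e 0 p, e 1 p])
    (hτ : ∀ᶠ s in 𝓝 (p 0), ContDiffAt ℝ ∞ τ s) (hτp : τ (p 0) ≠ 0)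
    (he0 : ∀ᶠ q in 𝓝 p, e 0 q 0 = 0)
    (hτ1 : ∀ᶠ q in 𝓝 p, deriv τ (q 0) * e 1 q 0 = τ (q 0)) :
    ∃ V ⊆ Ω, p ∈ V ∧ IsEquivalentOn V e (canonical 1) := by
  have hb : ∀ᶠ q in 𝓝 p, VectorField.lieBracket ℝ (e 0) (e 1) q = (1 : ℝ) • e 0 q := by
    simpa using hbr
  have hτq : ∀ᶠ q : Base in 𝓝 p, ContDiffAt ℝ ∞ τ (q 0) := (tendsto_time p).eventually hτ
  obtain ⟨z, hspan, hz⟩ := exists_third_vector hli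
  obtain ⟨m, hm0, hm1, hm2⟩ := hz 0 0 1
  obtain ⟨U, hUd, -, hU⟩ :=
    exists_fderiv_apply_eq_zero_and_const (k := fun _ => 1) (he 0) (he 1) hli hb m hm0
  obtain ⟨X, hX⟩ := exists_adapted_coordinate he hbr hli (S := fun q => τ (q 0)) (by
    filter_upwards [hτq, he0, hτ1] with q h1 h2 h3
    refine ⟨h1.comp q (contDiff_apply ℝ ℝ (0 : Fin 3)).contDiffAt, ?_, ?_⟩
    · rw [(hasFDerivAt_comp_time (h1.differentiableAt (by simp))).fderiv]
      simp [h2]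
    · rw [(hasFDerivAt_comp_time (h1.differentiableAt (by simp))).fderiv]
      simp [h3]) hτp
  have hp1 : deriv τ (p 0) * e 1 p 0 ≠ 0 := by rwa [hτ1.self_of_nhds]
  refine exists_isEquivalentOn_of_coordinates hΩ hp hτ
    (hX.mono fun q hq => hq.1) (hU.mono fun q hq => hq.1) (left_ne_zero_of_mul hp1) ?_ ?_
  · intro h h0 h1 h2
    obtain ⟨a, b, c, rfl⟩ := hspan h
    rw [hUd.fderiv] at h2
    have hc : c = 0 := by simpa [hm0, hm1, hm2] using h2
    subst hc
    have hb : b = 0 := by simpa [he0.self_of_nhds, right_ne_zero_of_mul hp1] using h0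
    subst hb
    have ha : a = 0 := by simpa [hX.self_of_nhds.2.1] using h1
    simp [ha]
  · filter_upwards [he0, hτ1, hX, hU] with q h0 h1 h2 h3
    rw [Fin.forall_fin_two]
    constructor <;> ext j <;> fin_cases j <;>
      simp [canonical, h0, h1, h2.2.1, h2.2.2, h3.2.1, h3.2.2, hm1]

/-- The case of a rank-two algebra tangent to the fibres `t = const`. -/
theorem exists_isEquivalentOn_canonical_two {Ω : Set Base} (hΩ : IsOpen Ω) {p : Base} (hp : p ∈ Ω)
    {e : Fin 2 → Base → Base}
    (he : ∀ i, ∀ᶠ q in 𝓝 p, ContDiffAt ℝ ∞ (e i) q)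
    (hbr : ∀ᶠ q in 𝓝 p, VectorField.lieBracket ℝ (e 0) (e 1) q = e 0 q)
    (hli : LinearIndependent ℝ ![e 0 p, e 1 p])
    (htime : ∀ i, ∀ᶠ q in 𝓝 p, e i q 0 = 0) :
    ∃ V ⊆ Ω, p ∈ V ∧ IsEquivalentOn V e (canonical 2) := by
  have hb : ∀ᶠ q in 𝓝 p, VectorField.lieBracket ℝ (e 0) (e 1) q = (1 : ℝ) • e 0 q := by
    simpa using hbr
  obtain ⟨z, hspan, hz⟩ := exists_third_vector hli
  obtain ⟨l, hl0, hl1, -⟩ := hz 0 1 0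
  obtain ⟨Z, hZd, -, hZ⟩ :=
    exists_fderiv_apply_eq_zero_and_const (k := fun _ => 1) (he 0) (he 1) hli hb l hl0
  obtain ⟨X, hX⟩ := exists_adapted_coordinate he hbr hli (S := fun q => Real.exp (Z q)) (by
    filter_upwards [hZ] with q h1
    refine ⟨h1.1.exp, ?_, ?_⟩
    · rw [(hasFDerivAt_exp_comp h1.1).fderiv]
      simp [h1.2.1]
    · rw [(hasFDerivAt_exp_comp h1.1).fderiv]
      simp [h1.2.2, hl1]) (Real.exp_ne_zero _)
  have ht0 := (htime 0).self_of_nhds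
  have ht1 := (htime 1).self_of_nhds
  refine exists_isEquivalentOn_of_coordinates hΩ hp (τ := id) (U := fun q => Real.exp (Z q))
    (Filter.Eventually.of_forall fun s => contDiffAt_id)
    (hX.mono fun q hq => hq.1) (hZ.mono fun q hq => hq.1.exp) (by simp) ?_ ?_
  · intro h h0 h1 h2
    -- Both fields are tangent to `t = const`, so the third basis vector must leave that plane.
    have hz0 : z 0 ≠ 0 := by
      intro hz0
      obtain ⟨a, b, c, habc⟩ := hspan (Pi.single 0 1)
      have := congrFun habc 0
      simp [ht0, ht1, hz0] at this
    obtain ⟨a, b, c, rfl⟩ := hspan h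
    have hc : c = 0 := by simpa [ht0, ht1, hz0] using h0
    subst hc
    rw [(hasFDerivAt_exp_comp hZ.self_of_nhds.1).fderiv, hZd.fderiv] at h2
    have hb : b = 0 := by simpa [hl0, hl1] using h2
    subst hb
    have ha : a = 0 := by simpa [hX.self_of_nhds.2.1] using h1
    simp [ha]
  · filter_upwards [htime 0, htime 1, hX, hZ] with q h0 h1 h2 h3
    rw [(hasFDerivAt_exp_comp h3.1).fderiv, Fin.forall_fin_two]
    constructor <;> ext j <;> fin_cases j <;>
      simp [canonical, h0, h1, h2.2.1, h2.2.2, h3.2.1, h3.2.2, hl1]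

/-- The case of a rank-one algebra tangent to the fibres `t = const`. -/
theorem exists_isEquivalentOn_canonical_three {Ω : Set Base} (hΩ : IsOpen Ω) {p : Base}
    (hp : p ∈ Ω) {e : Fin 2 → Base → Base} {X : Base → ℝ}
    (he : ∀ i, ∀ᶠ q in 𝓝 p, ContDiffAt ℝ ∞ (e i) q)
    (hbr : ∀ᶠ q in 𝓝 p, VectorField.lieBracket ℝ (e 0) (e 1) q = e 0 q)
    (hp0 : e 0 p ≠ 0) (hX : ∀ᶠ q in 𝓝 p, ContDiffAt ℝ ∞ X q)
    (hpar : ∀ᶠ q in 𝓝 p, e 1 q = X q • e 0 q)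
    (htime : ∀ᶠ q in 𝓝 p, e 0 q 0 = 0) :
    ∃ V ⊆ Ω, p ∈ V ∧ IsEquivalentOn V e (canonical 3) := by
  have hne : (∞ : WithTop ℕ∞) ≠ 0 := by simp
  -- `[e₁, X e₁] = (e₁ X) e₁` must equal `e₁`, which does not vanish.
  have hX1 : ∀ᶠ q in 𝓝 p, fderiv ℝ X q (e 0 q) = 1 := by
    have hnz : ∀ᶠ q in 𝓝 p, e 0 q ≠ 0 :=
      ((he 0).self_of_nhds.continuousAt).eventually_ne hp0
    filter_upwards [hpar.eventually_nhds, hbr, he 0, hX, hnz] with q h1 h2 h3 h4 h5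
    have h6 : VectorField.lieBracket ℝ (e 0) (e 1) q
        = VectorField.lieBracket ℝ (e 0) (fun q => X q • e 0 q) q := by
      have : e 1 =ᶠ[𝓝 q] fun q => X q • e 0 q := h1
      simp only [VectorField.lieBracket, this.fderiv_eq, this.self_of_nhds]
    rw [h6, VectorField.lieBracket_smul_right (h4.differentiableAt hne) (h3.differentiableAt hne),
      VectorField.lieBracket_self] at h2
    have h7 : (fderiv ℝ X q (e 0 q) - 1) • e 0 q = 0 := by
      rw [sub_smul, one_smul, sub_eq_zero]
      simpa using h2
    exact sub_eq_zero.1 ((smul_eq_zero.1 h7).resolve_right h5)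
  have ht := htime.self_of_nhds
  -- For `e₁ = b ∂_x + c ∂_u` at `p` this is `b du - c dx`, whose kernel in the plane `dt = 0` is
  -- exactly the line of `e₁`.
  set l : Base →L[ℝ] ℝ :=
    e 0 p 1 • ContinuousLinearMap.proj (R := ℝ) (φ := fun _ : Fin 3 => ℝ) 2
      - e 0 p 2 • ContinuousLinearMap.proj (R := ℝ) (φ := fun _ : Fin 3 => ℝ) 1 with hl
  have hlv : l (e 0 p) = 0 := by simp [hl, mul_comm]
  obtain ⟨U, hUd, -, hU⟩ := exists_fderiv_apply_eq_const (he 0) hp0 l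
  refine exists_isEquivalentOn_of_coordinates hΩ hp (τ := id)
    (Filter.Eventually.of_forall fun s => contDiffAt_id) hX
    (hU.mono fun q hq => hq.1) (by simp) ?_ ?_
  · intro h h0 h1 h2
    rw [hUd.fderiv] at h2
    have h2' : e 0 p 1 * h 2 = e 0 p 2 * h 1 := by simpa [hl, sub_eq_zero] using h2
    obtain ⟨c, hc⟩ : ∃ c : ℝ, h = c • e 0 p := by
      by_cases hb : e 0 p 1 = 0
      · have hc : e 0 p 2 ≠ 0 := by
          intro hc
          apply hp0
          ext j
          fin_cases j <;> simp [ht, hb, hc]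
        rw [hb, zero_mul, eq_comm, mul_eq_zero] at h2'
        refine ⟨h 2 / e 0 p 2, ?_⟩
        ext j
        fin_cases j <;> simp [ht, hb, hc, h0, h2'.resolve_left hc]
      · refine ⟨h 1 / e 0 p 1, ?_⟩
        ext j
        fin_cases j
        · simp [ht, h0]
        · simp [hb]
        · simp
          field_simp
          linarith
    rw [hc, map_smul, hX1.self_of_nhds] at h1
    have hc0 : c = 0 := by simpa using h1
    rw [hc, hc0, zero_smul]
  · filter_upwards [htime, hX1, hpar, hU] with q h0 h1 h2 h3
    rw [Fin.forall_fin_two]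
    constructor <;> ext j <;> fin_cases j <;>
      simp [canonical, h0, h1, h2, h3.2, hlv]

end EvolutionSymmetry

namespace EvolutionSymmetry

/-! ### Fields proportional over functions of `t` -/

theorem contDiff_baseOfJet3 : ContDiff ℝ ∞ baseOfJet3 := by
  rw [contDiff_pi]
  intro i
  fin_cases i <;> exact contDiff_apply ℝ ℝ _

theorem contDiffAt_pd {n : ℕ} {f : (Fin n → ℝ) → ℝ} {z : Fin n → ℝ} (i : Fin n)
    (hf : ContDiffAt ℝ ∞ f z) : ContDiffAt ℝ ∞ (pd i f) z :=
  (hf.fderiv_right (m := ∞) (by simp)).clm_apply contDiffAt_const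

theorem contDiffAt_totalDx {f : Jet3 → ℝ} {z : Jet3} (hf : ContDiffAt ℝ ∞ f z) :
    ContDiffAt ℝ ∞ (totalDx f) z := by
  have hc : ∀ i : Fin 6, ContDiffAt ℝ ∞ (fun z : Jet3 => z i) z := fun i =>
    (contDiff_apply ℝ ℝ i).contDiffAt
  exact (((contDiffAt_pd 1 hf).add ((hc 3).mul (contDiffAt_pd 2 hf))).add
    ((hc 4).mul (contDiffAt_pd 3 hf))).add ((hc 5).mul (contDiffAt_pd 4 hf))

theorem contDiffAt_component {Q : Base → Base} {z : Jet3}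
    (hQ : ContDiffAt ℝ ∞ Q (baseOfJet3 z)) (j : Fin 3) :
    ContDiffAt ℝ ∞ (fun y => Q (baseOfJet3 y) j) z :=
  ((contDiff_apply ℝ ℝ j).contDiffAt.comp z (hQ.comp z contDiff_baseOfJet3.contDiffAt) :)

theorem contDiffAt_prol1 {Q : Base → Base} {z : Jet3}
    (hQ : ContDiffAt ℝ ∞ Q (baseOfJet3 z)) : ContDiffAt ℝ ∞ (prol1 Q) z :=
  (contDiffAt_totalDx (contDiffAt_component hQ 2)).sub
    ((contDiff_apply ℝ ℝ (3 : Fin 6)).contDiffAt.mul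
      (contDiffAt_totalDx (contDiffAt_component hQ 1)))

theorem contDiffAt_prol2 {Q : Base → Base} {z : Jet3}
    (hQ : ContDiffAt ℝ ∞ Q (baseOfJet3 z)) : ContDiffAt ℝ ∞ (prol2 Q) z :=
  (contDiffAt_totalDx (contDiffAt_prol1 hQ)).sub
    ((contDiff_apply ℝ ℝ (4 : Fin 6)).contDiffAt.mul
      (contDiffAt_totalDx (contDiffAt_component hQ 1)))

/-- The derivative of `τ(t) f`. -/
theorem pd_time_mul {n : ℕ} {f g : (Fin (n + 1) → ℝ) → ℝ} {τ : ℝ → ℝ} {z : Fin (n + 1) → ℝ}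
    (hf : DifferentiableAt ℝ f z) (hτ : DifferentiableAt ℝ τ (z 0))
    (hg : g =ᶠ[𝓝 z] fun y => τ (y 0) * f y) (i : Fin (n + 1)) :
    pd i g z = τ (z 0) * pd i f z + (if i = 0 then deriv τ (z 0) * f z else 0) := by
  have h1 : HasFDerivAt (fun y : Fin (n + 1) → ℝ => τ (y 0))
      (deriv τ (z 0) • ContinuousLinearMap.proj (R := ℝ) (φ := fun _ : Fin (n + 1) => ℝ) 0) z :=
    hτ.hasDerivAt.comp_hasFDerivAt z (hasFDerivAt_apply (𝕜 := ℝ) (0 : Fin (n + 1)) z)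
  have h2 : HasFDerivAt (fun y => τ (y 0) * f y) _ z := h1.mul hf.hasFDerivAt
  rw [pd, hg.fderiv_eq, h2.fderiv]
  rcases eq_or_ne i 0 with rfl | hi
  · simp [pd, mul_comm]
  · simp [pd, hi]

/-- `D_x` does not differentiate `t`. Hence the `u_k`-coefficients of the prolongation of `τ(t) Q`
are `τ` times those of `Q`, and only the `u_t`-coefficient acquires a `τ'` term. -/
theorem totalDx_time_mul {f g : Jet3 → ℝ} {τ : ℝ → ℝ} {z : Jet3}
    (hf : DifferentiableAt ℝ f z) (hτ : DifferentiableAt ℝ τ (z 0))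
    (hg : g =ᶠ[𝓝 z] fun y => τ (y 0) * f y) : totalDx g z = τ (z 0) * totalDx f z := by
  simp only [totalDx, pd_time_mul hf hτ hg]
  simp
  ring

theorem totalDt_time_mul {f g : Base → ℝ} {τ : ℝ → ℝ} {q : Base}
    (hf : DifferentiableAt ℝ f q) (hτ : DifferentiableAt ℝ τ (q 0))
    (hg : g =ᶠ[𝓝 q] fun y => τ (y 0) * f y) (ut : ℝ) :
    totalDt g q ut = τ (q 0) * totalDt f q ut + deriv τ (q 0) * f q := by
  simp only [totalDt, pd_time_mul hf hτ hg]
  simp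
  ring

/-- A field `Q` with nonvanishing `∂_t`-component and a field `τ(t) Q` with `τ' ≠ 0` are not both
symmetries of an equation `u_t = F u_3 + G` with `F ≠ 0`. -/
theorem not_isSymmetry_of_time_proportional {N : Set Base} (hN : IsOpen N) {Q R : Base → Base}
    {τ : ℝ → ℝ} (hQ : ∀ q ∈ N, ContDiffAt ℝ ∞ Q q) (hτ : ∀ q ∈ N, ContDiffAt ℝ ∞ τ (q 0))
    (hR : ∀ q ∈ N, R q = τ (q 0) • Q q) {D : Set Jet2} {F G : Jet2 → ℝ} {w : Jet2} (hw : w ∈ D)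
    (hwN : baseOfJet2 w ∈ N) (hF : F w ≠ 0) (hQ0 : Q (baseOfJet2 w) 0 ≠ 0)
    (hτ' : deriv τ (w 0) ≠ 0) (hsQ : IsSymmetry D F G Q) (hsR : IsSymmetry D F G R) : False := by
  have hne : (∞ : WithTop ℕ∞) ≠ 0 := by simp
  have hO : IsOpen (baseOfJet3 ⁻¹' N) := hN.preimage contDiff_baseOfJet3.continuous
  have hcomp : ∀ z ∈ baseOfJet3 ⁻¹' N, ∀ j, R (baseOfJet3 z) j = τ (z 0) * Q (baseOfJet3 z) j := by
    intro z hz j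
    rw [hR _ hz]
    rfl
  have hB : ∀ z ∈ baseOfJet3 ⁻¹' N, ∀ j, totalDx (fun y => R (baseOfJet3 y) j) z
      = τ (z 0) * totalDx (fun y => Q (baseOfJet3 y) j) z := fun z hz j =>
    totalDx_time_mul ((contDiffAt_component (hQ _ hz) j).differentiableAt hne)
      ((hτ _ hz).differentiableAt hne)
      (by filter_upwards [hO.mem_nhds hz] with y hy using hcomp y hy j)
  have h1 : ∀ z ∈ baseOfJet3 ⁻¹' N, prol1 R z = τ (z 0) * prol1 Q z := by
    intro z hz
    simp only [prol1, totalDxB, hB z hz]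
    ring
  have h2 : ∀ z ∈ baseOfJet3 ⁻¹' N, prol2 R z = τ (z 0) * prol2 Q z := by
    intro z hz
    have := totalDx_time_mul ((contDiffAt_prol1 (hQ _ hz)).differentiableAt hne)
      ((hτ _ hz).differentiableAt hne)
      (by filter_upwards [hO.mem_nhds hz] with y hy using h1 y hy)
    simp only [prol2, totalDxB, hB z hz, this]
    ring
  have h3 : ∀ z ∈ baseOfJet3 ⁻¹' N, prol3 R z = τ (z 0) * prol3 Q z := by
    intro z hz
    have := totalDx_time_mul ((contDiffAt_prol2 (hQ _ hz)).differentiableAt hne)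
      ((hτ _ hz).differentiableAt hne)
      (by filter_upwards [hO.mem_nhds hz] with y hy using h2 y hy)
    simp only [prol3, totalDxB, hB z hz, this]
    ring
  have hT : ∀ z ∈ baseOfJet3 ⁻¹' N, ∀ ut, prolT R z ut = τ (z 0) * prolT Q z ut
      + deriv τ (z 0) * (Q (baseOfJet3 z) 2 - ut * Q (baseOfJet3 z) 0
        - z 3 * Q (baseOfJet3 z) 1) := by
    intro z hz ut
    have hz0 : baseOfJet3 z 0 = z 0 := rfl
    have : ∀ j, totalDt (fun p => R p j) (baseOfJet3 z) ut
        = τ (z 0) * totalDt (fun p => Q p j) (baseOfJet3 z) ut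
          + deriv τ (z 0) * Q (baseOfJet3 z) j := fun j => by
      have h := totalDt_time_mul (f := fun p => Q p j) (g := fun p => R p j)
        (((contDiff_apply ℝ ℝ j).contDiffAt.comp _ (hQ _ hz)).differentiableAt hne)
        ((hτ _ hz).differentiableAt hne)
        (by filter_upwards [hN.mem_nhds hz] with y hy; rw [hR y hy]; rfl) ut
      exact h
    simp only [prolT, this]
    ring
  -- The symmetry condition for `τ Q` minus `τ` times that for `Q` leaves `τ'` times the
  -- characteristic `c - u_t a - u_1 b`. The value `s` of `u_3` is free because `D` does not
  -- constrain it.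
  have key : ∀ s : ℝ, Q (baseOfJet2 w) 2 - (F w * s + G w) * Q (baseOfJet2 w) 0
      - w 3 * Q (baseOfJet2 w) 1 = 0 := by
    intro s
    set z : Jet3 := ![w 0, w 1, w 2, w 3, w 4, s] with hz
    have hzw : jet2OfJet3 z = w := by
      ext i
      fin_cases i <;> rfl
    have hzb : baseOfJet3 z = baseOfJet2 w := rfl
    have hzN : z ∈ baseOfJet3 ⁻¹' N := hwN
    have hz0 : z 0 = w 0 := rfl
    have hz3 : z 3 = w 3 := rfl
    have hz5 : z 5 = s := rfl
    have hA := hsQ z (by rwa [hzw])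
    have hB := hsR z (by rwa [hzw])
    have hP : ∀ H, prolApply R H z = τ (z 0) * prolApply Q H z := by
      intro H
      simp only [prolApply, h1 z hzN, h2 z hzN, hcomp z hzN]
      ring
    rw [hT z hzN, hP, hP, h3 z hzN, hzw, hzb, hz0, hz3, hz5] at hB
    rw [hzw, hz5] at hA
    refine (mul_eq_zero.1 ?_).resolve_left hτ'
    linear_combination hB - τ (w 0) * hA
  have h0 := key 0
  have h1' := key 1
  have : F w * Q (baseOfJet2 w) 0 = 0 := by linear_combination h0 - h1'
  exact mul_ne_zero hF hQ0 this

end EvolutionSymmetry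

namespace EvolutionSymmetry

/-! ### Ranks and regular points -/

section Rank

variable {E : Type*} [NormedAddCommGroup E] [NormedSpace ℝ E]

theorem finrank_span_pair_le (v : Fin 2 → E) :
    Module.finrank ℝ (Submodule.span ℝ (range v)) ≤ 2 :=
  (finrank_range_le_card (R := ℝ) v).trans (by simp)

theorem finrank_span_pair_eq_two_iff (v : Fin 2 → E) :
    Module.finrank ℝ (Submodule.span ℝ (range v)) = 2 ↔ LinearIndependent ℝ v := by
  rw [linearIndependent_iff_card_eq_finrank_span, Set.finrank, Fintype.card_fin, eq_comm]

theorem finrank_span_pair_eq_zero_iff [FiniteDimensional ℝ E] (v : Fin 2 → E) :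
    Module.finrank ℝ (Submodule.span ℝ (range v)) = 0 ↔ ∀ i, v i = 0 := by
  rw [Submodule.finrank_eq_zero, Submodule.span_eq_bot, forall_mem_range]

/-- The rank of a pair of vectors is lower semicontinuous. -/
theorem eventually_finrank_span_pair_le [FiniteDimensional ℝ E] {X : Type*}
    [TopologicalSpace X] {v : X → Fin 2 → E} {q : X}
    (hv : ContinuousAt v q) :
    ∀ᶠ x in 𝓝 q, Module.finrank ℝ (Submodule.span ℝ (range (v q)))
      ≤ Module.finrank ℝ (Submodule.span ℝ (range (v x))) := by
  by_cases h2 : LinearIndependent ℝ (v q)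
  · filter_upwards [hv.eventually h2.eventually] with x hx
    rw [(finrank_span_pair_eq_two_iff _).2 hx]
    exact finrank_span_pair_le _
  by_cases h0 : ∀ i, v q i = 0
  · exact Filter.Eventually.of_forall fun x => by
      rw [(finrank_span_pair_eq_zero_iff _).2 h0]
      exact Nat.zero_le _
  · push Not at h0
    obtain ⟨i, hi⟩ := h0
    have hvi : ContinuousAt (fun x => v x i) q := (continuous_apply i).continuousAt.comp hv
    filter_upwards [hvi.eventually_ne hi] with x hx
    have h1 : Module.finrank ℝ (Submodule.span ℝ (range (v x))) ≠ 0 := fun h =>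
      hx ((finrank_span_pair_eq_zero_iff _).1 h i)
    have h3 : Module.finrank ℝ (Submodule.span ℝ (range (v q))) ≠ 2 := fun h =>
      h2 ((finrank_span_pair_eq_two_iff _).1 h)
    have := finrank_span_pair_le (v q)
    omega

end Rank

theorem IsRealization.eventually_contDiffAt {Ω : Set Base} (hΩ : IsOpen Ω)
    {e : Fin 2 → Base → Base} (hr : IsRealization Ω e) {p : Base} (hp : p ∈ Ω) (i : Fin 2) :
    ∀ᶠ q in 𝓝 p, ContDiffAt ℝ ∞ (e i) q := by
  filter_upwards [hΩ.mem_nhds hp] with q hq using (hr.isField i).1.contDiffAt (hΩ.mem_nhds hq)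

/-- The regular points are dense in the set where `e₁` does not vanish. -/
theorem IsRealization.subset_closure_isRegularPoint {Ω : Set Base} (hΩ : IsOpen Ω)
    {e : Fin 2 → Base → Base} (hr : IsRealization Ω e) :
    {p | p ∈ Ω ∧ e 0 p ≠ 0} ⊆ closure {p | IsRegularPoint Ω e p} := by
  rintro p ⟨hp, hp0⟩
  rw [mem_closure_iff]
  intro O hO hpO
  have hcont : ∀ i, ∀ q ∈ Ω, ContinuousAt (e i) q := fun i q hq =>
    (hr.eventually_contDiffAt hΩ hq i).self_of_nhds.continuousAt
  -- Where the sum of the two lower semicontinuous ranks is maximal, neither can rise nearby, so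
  -- both are locally constant.
  set S : Set ℕ := {n | ∃ q ∈ O ∩ Ω, e 0 q ≠ 0 ∧ rankAt e q + timeRankAt e q = n} with hS
  have hbdd : BddAbove S := by
    refine ⟨4, ?_⟩
    rintro n ⟨q, -, -, rfl⟩
    have h1 := finrank_span_pair_le (fun i => e i q)
    have h2 := finrank_span_pair_le (fun i => e i q 0)
    unfold rankAt timeRankAt
    omega
  obtain ⟨q, hq, hq0, hqs⟩ := Nat.sSup_mem (s := S) ⟨_, p, ⟨hpO, hp⟩, hp0, rfl⟩ hbdd
  refine ⟨q, hq.1, hq.2, hq0, ?_⟩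
  have hev : ∀ᶠ x in 𝓝 q, rankAt e q ≤ rankAt e x :=
    eventually_finrank_span_pair_le (v := fun x i => e i x)
      (continuousAt_pi.2 fun i => hcont i q hq.2)
  have hevt : ∀ᶠ x in 𝓝 q, timeRankAt e q ≤ timeRankAt e x :=
    eventually_finrank_span_pair_le (v := fun x i => e i x 0)
      (continuousAt_pi.2 fun i => (continuous_apply 0).continuousAt.comp (hcont i q hq.2))
  filter_upwards [hev, hevt, (hO.inter hΩ).mem_nhds hq, (hcont 0 q hq.2).eventually_ne hq0]
    with x h1 h2 h3 h4
  have h5 : rankAt e x + timeRankAt e x ≤ rankAt e q + timeRankAt e q := by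
    rw [hqs]
    exact le_csSup hbdd ⟨x, h3, h4, rfl⟩
  omega

/-! ### The time components -/

/-- Restriction to the line through `p` parallel to the `t`-axis. -/
theorem eventually_time {p : Base} {P : ℝ → Prop} (h : ∀ᶠ q : Base in 𝓝 p, P (q 0)) :
    ∀ᶠ s in 𝓝 (p 0), P s := by
  have hc : Filter.Tendsto (fun s : ℝ => Function.update p 0 s) (𝓝 (p 0)) (𝓝 p) := by
    have : Continuous fun s : ℝ => Function.update p 0 s :=
      continuous_const.update 0 continuous_id
    have h := this.tendsto (p 0)
    rwa [Function.update_eq_self] at h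
  filter_upwards [hc.eventually h] with s hs
  simpa using hs

/-- `IsField` does not ask the function `a` to be smooth; near `p 0` it inherits smoothness from `Q`
along the `t`-line through `p`. -/
theorem IsField.exists_time_coefficient {Ω : Set Base} (hΩ : IsOpen Ω) {Q : Base → Base}
    (hQ : IsField Ω Q) {p : Base} (hp : p ∈ Ω) :
    ∃ a : ℝ → ℝ, (∀ᶠ s in 𝓝 (p 0), ContDiffAt ℝ ∞ a s) ∧ ∀ q ∈ Ω, Q q 0 = a (q 0) := by
  obtain ⟨hs, a, ha⟩ := hQ
  refine ⟨a, ?_, ha⟩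
  have hl : ContDiff ℝ ∞ fun s : ℝ => Function.update p 0 s := by
    rw [contDiff_pi]
    intro i
    rcases eq_or_ne i 0 with rfl | hi
    · simpa using contDiff_fun_id
    · simpa [hi] using contDiff_const
  have hev : ∀ᶠ s in 𝓝 (p 0), Function.update p 0 s ∈ Ω := by
    refine hl.continuous.continuousAt.eventually (hΩ.mem_nhds ?_)
    simpa using hp
  filter_upwards [hev.eventually_nhds] with s hs'
  have h1 : ContDiffAt ℝ ∞ (fun s => Q (Function.update p 0 s) 0) s :=
    (contDiff_apply ℝ ℝ (0 : Fin 3)).contDiffAt.comp s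
      ((hs.contDiffAt (hΩ.mem_nhds hs'.self_of_nhds)).comp s hl.contDiffAt)
  refine h1.congr_of_eventuallyEq ?_
  filter_upwards [hs'] with r hr
  rw [ha _ hr]
  simp

/-- The bracket relation for the time components. -/
theorem time_bracket {Ω : Set Base} (hΩ : IsOpen Ω) {e : Fin 2 → Base → Base}
    (hr : IsRealization Ω e) {a : Fin 2 → ℝ → ℝ} {p : Base}
    (ha : ∀ i, ∀ᶠ s in 𝓝 (p 0), ContDiffAt ℝ ∞ (a i) s)
    (hea : ∀ i, ∀ q ∈ Ω, e i q 0 = a i (q 0)) (hp : p ∈ Ω) :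
    ∀ᶠ s in 𝓝 (p 0), a 0 s * deriv (a 1) s - a 1 s * deriv (a 0) s = a 0 s := by
  refine eventually_time (P := fun s => a 0 s * deriv (a 1) s - a 1 s * deriv (a 0) s = a 0 s) ?_
  filter_upwards [hΩ.mem_nhds hp, (tendsto_time p).eventually (ha 0),
    (tendsto_time p).eventually (ha 1)] with q hq h0 h1
  have key : ∀ i, ContDiffAt ℝ ∞ (a i) (q 0) → ∀ h : Base,
      fderiv ℝ (e i) q h 0 = deriv (a i) (q 0) * h 0 := by
    intro i hi h
    have hd : DifferentiableAt ℝ (e i) q :=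
      ((hr.isField i).1.contDiffAt (hΩ.mem_nhds hq)).differentiableAt (by simp)
    have h2 := (hasFDerivAt_pi'.1 hd.hasFDerivAt) 0
    have h3 : (fun q => e i q 0) =ᶠ[𝓝 q] fun q => a i (q 0) := by
      filter_upwards [hΩ.mem_nhds hq] with x hx using hea i x hx
    have h4 := (hasFDerivAt_comp_time (hi.differentiableAt (by simp))).congr_of_eventuallyEq h3
    simpa using congrArg (fun L : Base →L[ℝ] ℝ => L h) (h2.unique h4)
  have hb := congrFun (hr.bracket q hq) 0
  rw [VectorField.lieBracket, Pi.sub_apply, key 0 h0, key 1 h1, hea 0 q hq, hea 1 q hq] at hb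
  linear_combination hb

/-- A field that is everywhere parallel to a nonvanishing field is a smooth multiple of it. -/
theorem exists_smooth_factor {v w : Base → Base} {p : Base}
    (hv : ∀ᶠ q in 𝓝 p, ContDiffAt ℝ ∞ v q) (hw : ∀ᶠ q in 𝓝 p, ContDiffAt ℝ ∞ w q)
    (hp : v p ≠ 0) (hdep : ∀ᶠ q in 𝓝 p, ¬ LinearIndependent ℝ ![v q, w q]) :
    ∃ X : Base → ℝ, (∀ᶠ q in 𝓝 p, ContDiffAt ℝ ∞ X q) ∧ ∀ᶠ q in 𝓝 p, w q = X q • v q := by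
  obtain ⟨j, hj⟩ := Function.ne_iff.1 hp
  have hvj : ContinuousAt (fun q => v q j) p :=
    (continuous_apply j).continuousAt.comp hv.self_of_nhds.continuousAt
  have hne := hvj.eventually_ne hj
  refine ⟨fun q => w q j / v q j, ?_, ?_⟩
  · filter_upwards [hv, hw, hne] with q h1 h2 h3
    have hc : ∀ {u : Base → Base}, ContDiffAt ℝ ∞ u q → ContDiffAt ℝ ∞ (fun q => u q j) q :=
      fun h => (contDiff_apply ℝ ℝ j).contDiffAt.comp q h
    exact (hc h2).div (hc h1) h3
  · filter_upwards [hdep, hne] with q h1 h2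
    have hvq : v q ≠ 0 := fun h => h2 (by rw [h])
    rw [LinearIndependent.pair_iff' hvq] at h1
    push Not at h1
    obtain ⟨c, hc⟩ := h1
    have h3 : c * v q j = w q j := by rw [← hc, Pi.smul_apply, smul_eq_mul]
    rw [← h3, mul_div_assoc, div_self h2, mul_one, hc]

/-! ### Case analysis at a regular point -/

/-- Near a regular point an admissible realization is equivalent to one of the canonical ones. -/
theorem IsRealization.exists_isEquivalentOn_canonical {Ω : Set Base} (hΩ : IsOpen Ω)
    {e : Fin 2 → Base → Base} (hr : IsRealization Ω e) (hadm : IsAdmissible Ω e) {p : Base}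
    (hreg : IsRegularPoint Ω e p) :
    ∃ V ⊆ Ω, p ∈ V ∧ ∃ k : Fin 4, IsEquivalentOn V e (canonical k) := by
  suffices ∃ k : Fin 4, ∃ V ⊆ Ω, p ∈ V ∧ IsEquivalentOn V e (canonical k) by
    obtain ⟨k, V, hV, hp, h⟩ := this
    exact ⟨V, hV, hp, k, h⟩
  obtain ⟨hp, hp0, hconst⟩ := hreg
  have hne : (∞ : WithTop ℕ∞) ≠ 0 := by simp
  have he := hr.eventually_contDiffAt hΩ hp
  have hbr : ∀ᶠ q in 𝓝 p, VectorField.lieBracket ℝ (e 0) (e 1) q = e 0 q := by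
    filter_upwards [hΩ.mem_nhds hp] with q hq using hr.bracket q hq
  have hpair : ∀ q, (fun i => e i q) = ![e 0 q, e 1 q] := fun q => by
    ext i : 1
    fin_cases i <;> rfl
  have hrank : ∀ q, rankAt e q = 2 ↔ LinearIndependent ℝ ![e 0 q, e 1 q] := fun q => by
    rw [rankAt, finrank_span_pair_eq_two_iff, hpair]
  have hdep : ¬ LinearIndependent ℝ ![e 0 p, e 1 p] →
      ∀ᶠ q in 𝓝 p, ¬ LinearIndependent ℝ ![e 0 q, e 1 q] := by
    intro h
    filter_upwards [hconst] with q hq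
    rw [← hrank, hq.1, hrank]
    exact h
  choose a ha hea using fun i => (hr.isField i).exists_time_coefficient hΩ hp
  have htb := time_bracket hΩ hr ha hea hp
  have hΩp := hΩ.mem_nhds hp
  by_cases h0 : e 0 p 0 = 0
  · by_cases h1 : e 1 p 0 = 0
    · have htr : timeRankAt e p = 0 := by
        rw [timeRankAt, finrank_span_pair_eq_zero_iff]
        exact Fin.forall_fin_two.2 ⟨h0, h1⟩
      have htime : ∀ i, ∀ᶠ q in 𝓝 p, e i q 0 = 0 := by
        intro i
        filter_upwards [hconst] with q hq
        have := hq.2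
        rw [htr, timeRankAt, finrank_span_pair_eq_zero_iff] at this
        exact this i
      by_cases hli : LinearIndependent ℝ ![e 0 p, e 1 p]
      · exact ⟨2, exists_isEquivalentOn_canonical_two hΩ hp he hbr hli htime⟩
      · obtain ⟨X, hX, hpar⟩ := exists_smooth_factor (he 0) (he 1) hp0 (hdep hli)
        exact ⟨3, exists_isEquivalentOn_canonical_three hΩ hp he hbr hp0 hX hpar (htime 0)⟩
    · have ha1 : a 1 (p 0) ≠ 0 := by rwa [← hea 1 p hp]
      have ha0 : a 0 (p 0) = 0 := by rwa [← hea 0 p hp]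
      -- The straightening result in dimension one gives a primitive `f` of `1/a₁`.
      obtain ⟨f, -, -, hf⟩ := exists_fderiv_apply_eq_const (ha 1) ha1
        ((a 1 (p 0))⁻¹ • ContinuousLinearMap.id ℝ ℝ)
      have hf' : ∀ᶠ s in 𝓝 (p 0), ContDiffAt ℝ ∞ f s ∧ deriv f s * a 1 s = 1 := by
        filter_upwards [hf] with s hs
        refine ⟨hs.1, ?_⟩
        have h2 := hs.2
        rw [fderiv_eq_smul_deriv, smul_eq_mul, mul_comm] at h2
        simpa [ha1] using h2
      set τ : ℝ → ℝ := fun s => Real.exp (f s) with hτ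
      have hτd : ∀ᶠ s in 𝓝 (p 0), HasDerivAt τ (τ s * deriv f s) s := by
        filter_upwards [hf'] with s hs
        exact (hs.1.differentiableAt hne).hasDerivAt.exp
      have hli : LinearIndependent ℝ ![e 0 p, e 1 p] := by
        rw [LinearIndependent.pair_iff' hp0]
        intro c hc
        apply h1
        rw [← hc, Pi.smul_apply, h0, smul_zero]
      -- The bracket relation is a linear equation for `a₀` with integral `(a₀/a₁) τ`; being zero at
      -- `p 0`, it is zero nearby.
      have hzero : ∀ᶠ s in 𝓝 (p 0), a 0 s = 0 := by
        have hd : ∀ᶠ s in 𝓝 (p 0), HasDerivAt (fun s => a 0 s / a 1 s * τ s) 0 s := by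
          have hc1 := (ha 1).self_of_nhds.continuousAt.eventually_ne ha1
          filter_upwards [ha 0, ha 1, hτd, hf', htb, hc1] with s s0 s1 s2 s3 s4 s5
          have h2 := (((s0.differentiableAt hne).hasDerivAt.div
            (s1.differentiableAt hne).hasDerivAt s5).mul s2)
          refine h2.congr_deriv ?_
          have h3 : deriv f s = 1 / a 1 s := by
            rw [eq_div_iff s5]; exact s3.2
          rw [h3]
          simp only [Pi.div_apply]
          field_simp
          linear_combination -τ s * s4
        obtain ⟨r, hr, hball⟩ := Metric.eventually_nhds_iff_ball.1 hd
        have hc1 := (ha 1).self_of_nhds.continuousAt.eventually_ne ha1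
        filter_upwards [Metric.ball_mem_nhds _ hr, hc1] with s hs hs1
        have h2 := (convex_ball (p 0) r).is_const_of_fderivWithin_eq_zero (𝕜 := ℝ)
          (f := fun s => a 0 s / a 1 s * τ s)
          (fun x hx => (hball x hx).differentiableAt.differentiableWithinAt)
          (fun x hx => by
            rw [fderivWithin_of_isOpen Metric.isOpen_ball hx]
            ext
            simp [(hball x hx).deriv]) hs (Metric.mem_ball_self hr)
        simpa [ha0, hs1, hτ] using h2
      refine ⟨1, exists_isEquivalentOn_canonical_one hΩ hp he hbr hli
        (hf'.mono fun s hs => hs.1.exp) (Real.exp_ne_zero _) ?_ ?_⟩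
      · filter_upwards [hΩp, (tendsto_time p).eventually hzero] with q hq h2
        rw [hea 0 q hq, h2]
      · filter_upwards [hΩp, (tendsto_time p).eventually hτd, (tendsto_time p).eventually hf']
          with q hq h2 h3
        rw [hea 1 q hq, h2.deriv, mul_assoc, h3.2, mul_one]
  · have ha0 : a 0 (p 0) ≠ 0 := by rwa [← hea 0 p hp]
    have hc0 := (ha 0).self_of_nhds.continuousAt.eventually_ne ha0
    -- Dividing the bracket relation by `a₀²` gives `τ' = 1/a₀`.
    set τ : ℝ → ℝ := fun s => a 1 s / a 0 s with hτ
    have hτs : ∀ᶠ s in 𝓝 (p 0), ContDiffAt ℝ ∞ τ s := by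
      filter_upwards [ha 0, ha 1, hc0] with s h1 h2 h3 using h2.div h1 h3
    have hτd : ∀ᶠ s in 𝓝 (p 0), deriv τ s * a 0 s = 1 := by
      filter_upwards [ha 0, ha 1, hc0, htb] with s h1 h2 h3 h4
      have h5 : HasDerivAt τ _ s :=
        (h2.differentiableAt hne).hasDerivAt.div (h1.differentiableAt hne).hasDerivAt h3
      rw [h5.deriv]
      field_simp
      linear_combination h4
    have hτ0 : ∀ᶠ q in 𝓝 p, deriv τ (q 0) * e 0 q 0 = 1 := by
      filter_upwards [hΩp, (tendsto_time p).eventually hτd] with q hq h1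
      rw [hea 0 q hq, h1]
    by_cases hli : LinearIndependent ℝ ![e 0 p, e 1 p]
    · refine ⟨0, exists_isEquivalentOn_canonical_zero hΩ hp he hbr hli hτs hτ0 ?_⟩
      filter_upwards [hΩp, (tendsto_time p).eventually hτd, (tendsto_time p).eventually hc0]
        with q hq h1 h2
      rw [hea 1 q hq, hτ]
      simp only
      rw [eq_div_iff h2]
      linear_combination a 1 (q 0) * h1
    -- In rank one the proportionality factor is read off from the time components, hence is the
    -- function `τ` of `t` alone.
    · exfalso
      obtain ⟨X, -, hpar⟩ := exists_smooth_factor (he 0) (he 1) hp0 (hdep hli)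
      have hpar' : ∀ᶠ q in 𝓝 p, e 1 q = τ (q 0) • e 0 q := by
        filter_upwards [hΩp, hpar, (tendsto_time p).eventually hc0] with q hq h1 h2
        have h3 := congrFun h1 0
        rw [Pi.smul_apply, hea 0 q hq, hea 1 q hq, smul_eq_mul] at h3
        rw [h1, hτ]
        simp only
        rw [h3, mul_div_assoc, div_self h2, mul_one]
      obtain ⟨D, F, G, -, hDΩ, -, -, hF, hsym⟩ := hadm
      obtain ⟨w, hw, hwp⟩ : p ∈ baseOfJet2 '' D := hDΩ ▸ hp
      obtain ⟨N, hN, hNo, hpN⟩ := eventually_nhds_iff.1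
        ((he 0).and (((tendsto_time p).eventually hτs).and hpar'))
      have hw0 : w 0 = p 0 := by rw [← hwp]; rfl
      refine not_isSymmetry_of_time_proportional hNo (fun q hq => (hN q hq).1)
        (fun q hq => (hN q hq).2.1) (fun q hq => (hN q hq).2.2) hw (by rwa [hwp]) (hF w hw)
        (by rwa [hwp]) ?_ (hsym 0) (hsym 1)
      rw [hw0]
      exact left_ne_zero_of_mul_eq_one hτ0.self_of_nhds

end EvolutionSymmetry

namespace EvolutionSymmetry

/-! ### The canonical realizations are admissible -/

/-- A field with components affine in `t`, `x`, `u` respectively. -/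
def affineField (d s : Base) (p : Base) : Base :=
  ![d 0 * p 0 + s 0, d 1 * p 1 + s 1, d 2 * p 2 + s 2]

theorem hasFDerivAt_affine_coordinate {n : ℕ} (c d : ℝ) (j : Fin n) (z : Fin n → ℝ) :
    HasFDerivAt (fun y : Fin n → ℝ => c * y j + d)
      (c • ContinuousLinearMap.proj (R := ℝ) (φ := fun _ : Fin n => ℝ) j) z :=
  ((hasFDerivAt_apply (𝕜 := ℝ) j z).const_mul c).add_const d

theorem pd_affine_coordinate {n : ℕ} (c d : ℝ) (i j : Fin n) (z : Fin n → ℝ) :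
    pd i (fun y : Fin n → ℝ => c * y j + d) z = if j = i then c else 0 := by
  rw [pd, (hasFDerivAt_affine_coordinate c d j z).fderiv]
  simp [Pi.single_apply]

theorem hasFDerivAt_affineField (d s p : Base) :
    HasFDerivAt (affineField d s) (ContinuousLinearMap.pi
      ![d 0 • ContinuousLinearMap.proj (R := ℝ) (φ := fun _ : Fin 3 => ℝ) 0,
        d 1 • ContinuousLinearMap.proj (R := ℝ) (φ := fun _ : Fin 3 => ℝ) 1,
        d 2 • ContinuousLinearMap.proj (R := ℝ) (φ := fun _ : Fin 3 => ℝ) 2]) p :=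
  hasFDerivAt_vec3 (hasFDerivAt_affine_coordinate _ _ 0 p)
    (hasFDerivAt_affine_coordinate _ _ 1 p) (hasFDerivAt_affine_coordinate _ _ 2 p)

theorem isField_affineField (d s : Base) : IsField univ (affineField d s) := by
  refine ⟨fun p _ => ?_, fun t => d 0 * t + s 0, fun p _ => rfl⟩
  have h : ∀ j : Fin 3, ContDiffAt ℝ ∞ (fun p : Base => d j * p j + s j) p := fun j =>
    (contDiffAt_const.mul (contDiff_apply ℝ ℝ j).contDiffAt).add contDiffAt_const
  exact (contDiffAt_vec3 (h 0) (h 1) (h 2)).contDiffWithinAt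

theorem lieBracket_affineField (d s d' s' p : Base) :
    VectorField.lieBracket ℝ (affineField d s) (affineField d' s') p
      = fun j => d' j * affineField d s p j - d j * affineField d' s' p j := by
  rw [VectorField.lieBracket, (hasFDerivAt_affineField d s p).fderiv,
    (hasFDerivAt_affineField d' s' p).fderiv]
  ext j
  fin_cases j <;> simp

section Prolongation

variable (d s : Base)

theorem totalDxB_affineField (z : Jet3) : totalDxB (affineField d s) z = d 1 := by
  have h : (fun y : Jet3 => affineField d s (baseOfJet3 y) 1) = fun y => d 1 * y 1 + s 1 := rfl
  rw [totalDxB, h, totalDx]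
  simp [pd_affine_coordinate]

/-- The `+ 0` keeps the form to which `pd_affine_coordinate` applies in the next prolongation. -/
theorem prol1_affineField : prol1 (affineField d s) = fun z => (d 2 - d 1) * z 3 + 0 := by
  ext z
  have h : (fun y : Jet3 => affineField d s (baseOfJet3 y) 2) = fun y => d 2 * y 2 + s 2 := rfl
  rw [prol1, h, totalDxB_affineField, totalDx]
  simp [pd_affine_coordinate]
  ring

theorem prol2_affineField : prol2 (affineField d s) = fun z => (d 2 - 2 * d 1) * z 4 + 0 := by
  ext z
  rw [prol2, prol1_affineField, totalDxB_affineField, totalDx]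
  simp only [pd_affine_coordinate]
  simp
  ring

theorem prol3_affineField (z : Jet3) :
    prol3 (affineField d s) z = (d 2 - 3 * d 1) * z 5 := by
  rw [prol3, prol2_affineField, totalDxB_affineField, totalDx]
  simp only [pd_affine_coordinate]
  simp
  ring

theorem prolT_affineField (z : Jet3) (ut : ℝ) :
    prolT (affineField d s) z ut = (d 2 - d 0) * ut := by
  have h : ∀ j : Fin 3, (fun p : Base => affineField d s p j) = fun p => d j * p j + s j := by
    intro j
    fin_cases j <;> rfl
  simp only [prolT, h, totalDt, pd_affine_coordinate]
  simp
  ring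

end Prolongation

/-- The coefficient `u_1^{-m} u_2^{-n}`. -/
noncomputable def powerCoefficient (m n : ℕ) (w : Jet2) : ℝ := (w 3 ^ m * w 4 ^ n)⁻¹

theorem hasFDerivAt_powerCoefficient (m n : ℕ) {w : Jet2} (h3 : w 3 ≠ 0) (h4 : w 4 ≠ 0) :
    HasFDerivAt (powerCoefficient m n)
      (-(powerCoefficient m n w * (m / w 3)) •
          ContinuousLinearMap.proj (R := ℝ) (φ := fun _ : Fin 5 => ℝ) 3
        - (powerCoefficient m n w * (n / w 4)) •
          ContinuousLinearMap.proj (R := ℝ) (φ := fun _ : Fin 5 => ℝ) 4) w := by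
  have hpow : ∀ (j : Fin 5) (k : ℕ), w j ≠ 0 → HasFDerivAt (fun w : Jet2 => w j ^ k)
      ((w j ^ k * (k / w j)) • ContinuousLinearMap.proj (R := ℝ) (φ := fun _ : Fin 5 => ℝ) j)
      w := by
    intro j k hj
    have h := (hasDerivAt_pow k (w j)).comp_hasFDerivAt w
      (hasFDerivAt_apply (𝕜 := ℝ) (F' := fun _ : Fin 5 => ℝ) j w)
    refine h.congr_fderiv ?_
    congr 1
    rcases k with - | k
    · simp
    · rw [Nat.add_sub_cancel, pow_succ]
      field_simp
  have hne : w 3 ^ m * w 4 ^ n ≠ 0 := mul_ne_zero (pow_ne_zero _ h3) (pow_ne_zero _ h4)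
  have h := (hasDerivAt_inv hne).comp_hasFDerivAt w ((hpow 3 m h3).mul (hpow 4 n h4))
  refine h.congr_fderiv ?_
  ext v
  simp only [powerCoefficient, smul_apply, add_apply,
    sub_apply, ContinuousLinearMap.proj_apply, smul_eq_mul]
  field_simp
  ring

/-- Under the scaling, `u_t` has weight `d 2 - d 0` and `u_k` has weight `d 2 - k * d 1`; the
hypothesis says that `u_1^{-m} u_2^{-n} u_3` has the weight of `u_t`. Translations impose nothing,
since the coefficient does not involve `t`, `x`, `u`. -/
theorem isSymmetry_affineField (d s : Base) {m n : ℕ}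
    (h : d 2 - d 0 + m * (d 2 - d 1) + n * (d 2 - 2 * d 1) = d 2 - 3 * d 1) :
    IsSymmetry {w | w 3 ≠ 0 ∧ w 4 ≠ 0} (powerCoefficient m n) (fun _ => 0) (affineField d s) := by
  rintro z ⟨h3, h4⟩
  have hF := hasFDerivAt_powerCoefficient m n h3 h4
  have hG : ∀ i, pd i (fun _ : Jet2 => (0 : ℝ)) (jet2OfJet3 z) = 0 := fun i => by simp [pd]
  have hw3 : jet2OfJet3 z 3 = z 3 := rfl
  have hw4 : jet2OfJet3 z 4 = z 4 := rfl
  rw [hw3] at h3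
  rw [hw4] at h4
  have h0 : ∀ i : Fin 5, pd i (powerCoefficient m n) (jet2OfJet3 z)
      = -(powerCoefficient m n (jet2OfJet3 z) * (m / z 3)) * (if i = 3 then 1 else 0)
        - powerCoefficient m n (jet2OfJet3 z) * (n / z 4) * (if i = 4 then 1 else 0) := by
    intro i
    rw [pd, hF.fderiv]
    simp [Pi.single_apply, hw3, hw4, eq_comm]
  simp only [prolApply, hG, prolT_affineField, prol1_affineField, prol2_affineField,
    prol3_affineField, h0]
  simp
  field_simp
  linear_combination powerCoefficient m n (jet2OfJet3 z) * z 5 * h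

theorem isAdmissible_affineField (d s : Fin 2 → Base) {m n : ℕ}
    (h : ∀ i, d i 2 - d i 0 + m * (d i 2 - d i 1) + n * (d i 2 - 2 * d i 1)
      = d i 2 - 3 * d i 1) :
    IsAdmissible univ (fun i => affineField (d i) (s i)) := by
  refine ⟨{w | w 3 ≠ 0 ∧ w 4 ≠ 0}, powerCoefficient m n, fun _ => 0, ?_, ?_, ?_,
    contDiffOn_const, ?_, fun i => isSymmetry_affineField _ _ (h i)⟩
  · exact (isOpen_ne_fun (continuous_apply 3) continuous_const).inter
      (isOpen_ne_fun (continuous_apply 4) continuous_const)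
  · refine eq_univ_of_forall fun p => ⟨![p 0, p 1, p 2, 1, 1], by simp, ?_⟩
    ext i
    fin_cases i <;> rfl
  · rintro w ⟨h3, h4⟩
    have hc : ∀ j : Fin 5, ContDiffAt ℝ ∞ (fun w : Jet2 => w j) w := fun j =>
      (contDiff_apply ℝ ℝ j).contDiffAt
    exact ((((hc 3).pow m).mul ((hc 4).pow n)).inv
      (mul_ne_zero (pow_ne_zero _ h3) (pow_ne_zero _ h4))).contDiffWithinAt
  · rintro w ⟨h3, h4⟩
    exact inv_ne_zero (mul_ne_zero (pow_ne_zero _ h3) (pow_ne_zero _ h4))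

/-- Linear parts of the canonical fields. -/
def canonicalLinear : Fin 4 → Fin 2 → Base :=
  ![![0, ![1, 1, 0]], ![0, ![1, 1, 0]], ![0, ![0, 1, 1]], ![0, ![0, 1, 0]]]

/-- Constant parts of the canonical fields. -/
def canonicalConst : Fin 4 → Fin 2 → Base :=
  ![![![1, 0, 0], 0], ![![0, 1, 0], 0], ![![0, 1, 0], 0], ![![0, 1, 0], 0]]

theorem canonical_eq_affineField (k : Fin 4) :
    canonical k = fun i => affineField (canonicalLinear k i) (canonicalConst k i) := by
  ext i p j
  fin_cases k <;> fin_cases i <;> fin_cases j <;>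
    simp [canonical, affineField, canonicalLinear, canonicalConst]

theorem isRealization_canonical (k : Fin 4) : IsRealization univ (canonical k) := by
  refine ⟨fun i => ?_, ?_, fun p _ => ?_⟩
  · rw [canonical_eq_affineField]
    exact isField_affineField _ _
  · rw [Fintype.linearIndependent_iff]
    intro g hg
    have h0 := congrFun hg ⟨0, mem_univ _⟩
    have h1 := congrFun hg ⟨1, mem_univ _⟩
    have h00 := congrFun h0 0
    have h01 := congrFun h0 1
    have h11 := congrFun h1 1
    rw [Fin.forall_fin_two]
    fin_cases k <;> simp [canonical, Set.domRestrict] at h00 h01 h11 <;> simp_all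
  · rw [canonical_eq_affineField, lieBracket_affineField]
    ext j
    fin_cases k <;> fin_cases j <;> simp [affineField, canonicalLinear, canonicalConst]

/-- For scaling weights `(1,1,0)`, `(0,1,1)`, `(0,1,0)` of `(t,x,u)` the exponents must satisfy `m +
2n = 2`, `n = 3` and `m + 2n = 3` respectively. -/
theorem isAdmissible_canonical (k : Fin 4) : IsAdmissible univ (canonical k) := by
  rw [canonical_eq_affineField]
  fin_cases k
  · exact isAdmissible_affineField _ _ (m := 2) (n := 0) (by
      rw [Fin.forall_fin_two]; constructor <;> simp [canonicalLinear]; norm_num)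
  · exact isAdmissible_affineField _ _ (m := 2) (n := 0) (by
      rw [Fin.forall_fin_two]; constructor <;> simp [canonicalLinear]; norm_num)
  · exact isAdmissible_affineField _ _ (m := 0) (n := 3) (by
      rw [Fin.forall_fin_two]; constructor <;> simp [canonicalLinear]; norm_num)
  · exact isAdmissible_affineField _ _ (m := 3) (n := 0) (by
      rw [Fin.forall_fin_two]; constructor <;> simp [canonicalLinear])

/-! ### The canonical realizations are pairwise inequivalent -/

theorem exists_mem_coordinate_ne {V : Set Base} (hV : IsOpen V) (hne : V.Nonempty) (j : Fin 3)
    (c : ℝ) : ∃ q ∈ V, q j ≠ c := by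
  by_contra! h
  have h1 : (fun q : Base => q j) '' V = {c} := by
    obtain ⟨q, hq⟩ := hne
    refine Subset.antisymm ?_ ?_
    · rintro _ ⟨x, hx, rfl⟩
      exact h x hx
    · rintro _ rfl
      exact ⟨q, hq, h q hq⟩
  exact not_isOpen_singleton c (h1 ▸ isOpenMap_eval j V hV)

namespace IsEquivTransformation

variable {V : Set Base} {Φ : Base → Base}

theorem fderiv_bijective
    (hΦ : IsEquivTransformation V Φ) {p : Base} (hp : p ∈ V) :
    Function.Bijective (fderiv ℝ Φ p) := by
  exact (LinearMap.equivOfDetNeZero (fderiv ℝ Φ p : Base →ₗ[ℝ] Base)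
    (hΦ.det_ne_zero p hp)).bijective

theorem hasFDerivAt (hΦ : IsEquivTransformation V Φ) {p : Base} (hp : p ∈ V) :
    HasFDerivAt Φ (fderiv ℝ Φ p) p :=
  ((hΦ.contDiffOn.contDiffAt (hΦ.isOpen.mem_nhds hp)).differentiableAt (by simp)).hasFDerivAt

/-- The function `T` is not assumed differentiable, so the argument works with `Φ`: its time
component is constant along directions with `dt = 0`, and its differential is nonzero because that
of `Φ` is onto. -/
theorem exists_fderiv_time (hΦ : IsEquivTransformation V Φ) {p : Base} (hp : p ∈ V) :
    ∃ c : ℝ, c ≠ 0 ∧ ∀ h : Base, fderiv ℝ Φ p h 0 = c * h 0 := by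
  obtain ⟨T, -, hT⟩ := hΦ.time
  have hd := hasFDerivAt_pi'.1 (hΦ.hasFDerivAt hp) 0
  have hzero : ∀ h : Base, h 0 = 0 → fderiv ℝ Φ p h 0 = 0 := by
    intro h h0
    have hl : HasDerivAt (fun r : ℝ => p + r • h) h 0 := by
      simpa using ((hasDerivAt_id (0 : ℝ)).smul_const h).const_add p
    have hd' : HasFDerivAt (fun q : Base => Φ q 0)
        ((ContinuousLinearMap.proj 0).comp (fderiv ℝ Φ p)) (p + (0 : ℝ) • h) := by
      rw [zero_smul, add_zero]; exact hd
    have h1 := hd'.comp_hasDerivAt (0 : ℝ) hl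
    have h2 : ((fun q => Φ q 0) ∘ fun r : ℝ => p + r • h) =ᶠ[𝓝 0] fun _ => T (p 0) := by
      have hc : ContinuousAt (fun r : ℝ => p + r • h) 0 := hl.continuousAt
      have hV : V ∈ 𝓝 (p + (0 : ℝ) • h) := by
        rw [zero_smul, add_zero]; exact hΦ.isOpen.mem_nhds hp
      filter_upwards [hc.eventually hV] with r hr
      simp only [Function.comp_apply]
      rw [hT _ hr]
      simp [h0]
    exact h1.unique ((hasDerivAt_const (0 : ℝ) (T (p 0))).congr_of_eventuallyEq h2)
  have hform : ∀ h : Base, fderiv ℝ Φ p h 0 = fderiv ℝ Φ p (Pi.single 0 1) 0 * h 0 := by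
    intro h
    have h1 := hzero (h - h 0 • Pi.single 0 1) (by simp)
    rw [map_sub, map_smul, Pi.sub_apply, Pi.smul_apply, sub_eq_zero, smul_eq_mul] at h1
    rw [h1, mul_comm]
  refine ⟨_, fun hc => ?_, hform⟩
  obtain ⟨h, hh⟩ := (hΦ.fderiv_bijective hp).2 (Pi.single 0 1)
  have := congrFun hh 0
  rw [hform, hc] at this
  simp at this

theorem exists_time_ne (hΦ : IsEquivTransformation V Φ) {p : Base} (hp : p ∈ V) :
    ∃ q ∈ V, q 0 ≠ p 0 ∧ Φ q 0 ≠ Φ p 0 := by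
  obtain ⟨T, hTi, hT⟩ := hΦ.time
  obtain ⟨q, hq, hqp⟩ := exists_mem_coordinate_ne hΦ.isOpen ⟨p, hp⟩ 0 (p 0)
  refine ⟨q, hq, hqp, fun h => hqp ?_⟩
  rw [hT q hq, hT p hp] at h
  exact hTi ⟨q, hq, rfl⟩ ⟨p, hp, rfl⟩ h

theorem exists_image_coordinate_ne_zero (hΦ : IsEquivTransformation V Φ) (hV : V.Nonempty)
    (j : Fin 3) : ∃ q ∈ V, Φ q j ≠ 0 := by
  by_contra! h
  obtain ⟨p, hp⟩ := hV
  have hd := hasFDerivAt_pi'.1 (hΦ.hasFDerivAt hp) j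
  have h2 : (fun q => Φ q j) =ᶠ[𝓝 p] fun _ => 0 := by
    filter_upwards [hΦ.isOpen.mem_nhds hp] with q hq using h q hq
  have h3 := hd.unique ((hasFDerivAt_const (0 : ℝ) p).congr_of_eventuallyEq h2)
  obtain ⟨v, hv⟩ := (hΦ.fderiv_bijective hp).2 (Pi.single j 1)
  have h4 := congrArg (fun L : Base →L[ℝ] ℝ => L v) h3
  have h5 := congrFun hv j
  simp at h4 h5
  rw [h4] at h5
  exact zero_ne_one h5

end IsEquivTransformation

/-- Time coefficients transform by a nonzero factor and the matrix `M`, which separates the first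
two algebras from each other and from the rest; the last two differ in rank. -/
theorem eq_of_isEquivalentOn_canonical {k l : Fin 4} {V : Set Base} (hV : V.Nonempty)
    (h : IsEquivalentOn V (canonical k) (canonical l)) : k = l := by
  obtain ⟨Φ, hΦ, M, hM, hE⟩ := h
  rw [Matrix.det_fin_two] at hM
  simp only [Fin.sum_univ_two] at hE
  by_contra hkl
  have htime : ∀ p ∈ V, ∃ c : ℝ, c ≠ 0 ∧ ∀ i, c * canonical k i p 0
      = M i 0 * canonical l 0 (Φ p) 0 + M i 1 * canonical l 1 (Φ p) 0 := by
    intro p hp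
    obtain ⟨c, hc, hcf⟩ := hΦ.exists_fderiv_time hp
    refine ⟨c, hc, fun i => ?_⟩
    rw [← hcf, hE p hp i]
    rfl
  -- The new time takes at least two values on `V`.
  have hline : ∀ {α β : ℝ}, (∀ p ∈ V, α + β * Φ p 0 = 0) → α = 0 ∧ β = 0 := by
    intro α β hαβ
    obtain ⟨p, hp⟩ := hV
    obtain ⟨q, hq, -, hqp⟩ := hΦ.exists_time_ne hp
    have h1 := hαβ p hp
    have h2 := hαβ q hq
    have hβ : β = 0 := by
      have : β * (Φ q 0 - Φ p 0) = 0 := by linear_combination h2 - h1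
      exact (mul_eq_zero.1 this).resolve_right (sub_ne_zero.2 hqp)
    exact ⟨by simpa [hβ] using h1, hβ⟩
  have hto0 : (∀ p, canonical k 0 p 0 = 0) → l ≠ 0 := by
    rintro hk rfl
    obtain ⟨h0, h1⟩ := hline (α := M 0 0) (β := M 0 1) fun p hp => by
      obtain ⟨c, -, hc⟩ := htime p hp
      have := hc 0
      rw [hk] at this
      simp [canonical] at this
      exact this.symm
    rw [h0, h1] at hM
    simp at hM
  have hto1 : (∀ i p, canonical k i p 0 = 0) → l ≠ 1 := by
    rintro hk rfl
    have h1 : ∀ i, M i 1 = 0 := fun i => (hline (α := 0) (β := M i 1) fun p hp => by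
      obtain ⟨c, -, hc⟩ := htime p hp
      have := hc i
      rw [hk] at this
      simpa [canonical] using this).2
    rw [h1, h1] at hM
    simp at hM
  have hto23 : (∀ i p, canonical l i p 0 = 0) → ∀ p ∈ V, ∀ i, canonical k i p 0 = 0 := by
    intro hl p hp i
    obtain ⟨c, hc0, hc⟩ := htime p hp
    have := hc i
    rw [hl, hl] at this
    simpa [hc0] using this
  obtain ⟨p, hp⟩ := hV
  have hp0 : ∃ q ∈ V, q 0 ≠ 0 := exists_mem_coordinate_ne hΦ.isOpen ⟨p, hp⟩ 0 0
  have hl2 : ∀ i p, canonical 2 i p 0 = 0 := Fin.forall_fin_two.2 ⟨fun _ => rfl, fun _ => rfl⟩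
  have hl3 : ∀ i p, canonical 3 i p 0 = 0 := Fin.forall_fin_two.2 ⟨fun _ => rfl, fun _ => rfl⟩
  have hk1 : ∀ p, canonical 1 0 p 0 = 0 := fun _ => rfl
  have hk01 : (∀ i p, canonical l i p 0 = 0) → k ≠ 0 ∧ k ≠ 1 := by
    intro hl
    obtain ⟨q, hq, hq0⟩ := hp0
    have := hto23 hl q hq 1
    constructor <;> rintro rfl <;> exact hq0 this
  -- With `T` the new time, `c = M₀₁ T` and `c t = M₁₁ T` force `M₁₁ = t M₀₁` for varying `t`, so
  -- `M₀₁ = 0` and `c = 0`.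
  have h01 : ¬ (k = 0 ∧ l = 1) := by
    rintro ⟨rfl, rfl⟩
    have hrel : ∀ q ∈ V, M 1 1 = q 0 * M 0 1 := by
      intro q hq
      obtain ⟨c, hc0, hc⟩ := htime q hq
      have h0 := hc 0
      have h1 := hc 1
      simp [canonical] at h0 h1
      have hT : Φ q 0 ≠ 0 := fun hT => hc0 (by rw [h0, hT, mul_zero])
      apply mul_right_cancel₀ hT
      rw [← h1, h0]
      ring
    obtain ⟨q, hq, hqp, -⟩ := hΦ.exists_time_ne hp
    have h1 := hrel p hp
    have h2 := hrel q hq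
    have h3 : (q 0 - p 0) * M 0 1 = 0 := by linear_combination h1 - h2
    have h4 : M 0 1 = 0 := (mul_eq_zero.1 h3).resolve_left (sub_ne_zero.2 hqp)
    obtain ⟨c, hc0, hc⟩ := htime p hp
    have h0 := hc 0
    simp [canonical, h4] at h0
    exact hc0 h0
  -- Where `u ≠ 0` the fields of the third algebra are independent, while both images would be
  -- multiples of `∂_x`.
  have h23 : ¬ (k = 2 ∧ l = 3) := by
    rintro ⟨rfl, rfl⟩
    obtain ⟨q, hq, hq2⟩ := exists_mem_coordinate_ne hΦ.isOpen ⟨p, hp⟩ 2 0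
    have hinj := (hΦ.fderiv_bijective hq).1
    have himg : ∀ i, fderiv ℝ Φ q (canonical 2 i q) = (M i 0 + M i 1 * Φ q 1) • ![0, 1, 0] := by
      intro i
      rw [hE q hq i]
      ext j
      fin_cases j <;> simp [canonical]
    set α := M 0 0 + M 0 1 * Φ q 1 with hα
    set β := M 1 0 + M 1 1 * Φ q 1 with hβ
    have h1 : β • canonical 2 0 q = α • canonical 2 1 q := by
      apply hinj
      rw [map_smul, map_smul, himg, himg, ← hα, ← hβ, smul_smul, smul_smul, mul_comm]
    have h2 := congrFun h1 2
    have hα0 : α = 0 := by simpa [canonical, hq2] using h2.symm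
    have h3 : canonical 2 0 q = 0 := by
      apply hinj
      rw [himg, ← hα, hα0, zero_smul, map_zero]
    have h4 := congrFun h3 1
    simp [canonical] at h4
  -- At a point whose image has `u ≠ 0` the target fields are independent, so `e₂ = x e₁` makes the
  -- rows of `M` proportional.
  have h32 : ¬ (k = 3 ∧ l = 2) := by
    rintro ⟨rfl, rfl⟩
    obtain ⟨q, hq, hq2⟩ := hΦ.exists_image_coordinate_ne_zero ⟨p, hp⟩ 2
    have h0 := hE q hq 0
    have h1 := hE q hq 1
    have h2 : canonical 3 1 q = q 1 • canonical 3 0 q := by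
      ext j
      fin_cases j <;> simp [canonical]
    rw [h2, map_smul, h0] at h1
    have h3 := congrFun h1 1
    have h4 := congrFun h1 2
    simp [canonical] at h3 h4
    have h5 : M 1 1 = q 1 * M 0 1 := by
      apply mul_right_cancel₀ hq2
      linear_combination -h4
    apply hM
    have h6 : M 1 0 = q 1 * M 0 0 := by
      rw [h5] at h3
      linear_combination -h3
    rw [h5, h6]
    ring
  fin_cases l
  · fin_cases k
    · exact hkl rfl
    · exact hto0 hk1 rfl
    · exact hto0 (hl2 0) rfl
    · exact hto0 (hl3 0) rfl
  · fin_cases k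
    · exact h01 ⟨rfl, rfl⟩
    · exact hkl rfl
    · exact hto1 hl2 rfl
    · exact hto1 hl3 rfl
  · fin_cases k
    · exact (hk01 hl2).1 rfl
    · exact (hk01 hl2).2 rfl
    · exact hkl rfl
    · exact h32 ⟨rfl, rfl⟩
  · fin_cases k
    · exact (hk01 hl3).1 rfl
    · exact (hk01 hl3).2 rfl
    · exact h23 ⟨rfl, rfl⟩
    · exact hkl rfl

end EvolutionSymmetry

theorem mainTheorem4 :
    -- each of the four algebras is an admissible realization
    (∀ k : Fin 4, EvolutionSymmetry.IsRealization Set.univ (EvolutionSymmetry.canonical k) ∧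
      EvolutionSymmetry.IsAdmissible Set.univ (EvolutionSymmetry.canonical k)) ∧
    -- every admissible realization is, near each regular point, equivalent to one of the four,
    -- and the regular points are dense where `e_1` does not vanish
    (∀ (Ω : Set EvolutionSymmetry.Base)
        (e : Fin 2 → EvolutionSymmetry.Base → EvolutionSymmetry.Base),
      IsOpen Ω → EvolutionSymmetry.IsRealization Ω e → EvolutionSymmetry.IsAdmissible Ω e →
        (∀ p, EvolutionSymmetry.IsRegularPoint Ω e p →
          ∃ V ⊆ Ω, p ∈ V ∧
            ∃ k : Fin 4, EvolutionSymmetry.IsEquivalentOn V e (EvolutionSymmetry.canonical k)) ∧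
        {p | p ∈ Ω ∧ e 0 p ≠ 0} ⊆ closure {p | EvolutionSymmetry.IsRegularPoint Ω e p}) ∧
    -- no two of the four are equivalent, not even locally
    (∀ (k l : Fin 4) (V : Set EvolutionSymmetry.Base), V.Nonempty →
      EvolutionSymmetry.IsEquivalentOn V (EvolutionSymmetry.canonical k)
        (EvolutionSymmetry.canonical l) → k = l) := by
  refine ⟨fun k => ⟨EvolutionSymmetry.isRealization_canonical k,
      EvolutionSymmetry.isAdmissible_canonical k⟩,
    fun Ω e hΩ hr hadm => ⟨fun p hp => hr.exists_isEquivalentOn_canonical hΩ hadm hp,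
      hr.subset_closure_isRegularPoint hΩ⟩,
    fun k l V hV h => EvolutionSymmetry.eq_of_isEquivalentOn_canonical hV h⟩
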